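/- **Setting.** Let $\mathcal X$ (contexts) and $\mathcal A$ (arms) be subsets of finite-dimensional real normed spaces, and let $\mathcal H$ be a reproducing kernel Hilbert space of real functions on $\mathcal Z=\mathcal X\times\mathcal A$ with a measurable kernel $k$ satisfying $k(z,z)\le 1$ for all $z$. Let $f\in\mathcal H$ with $\|f\|_{\mathcal H}\le B$, and fix $\lambda\ge 1$, $b\ge 0$, $\delta\in(0,1)$ and $\Delta$. The rounds are $t=1,2,\dots$, with a finite or infinite number $N$ of them. In round $t$ the agent observes an imperfect context $\hat x_t\in\mathcal X$ and selects an arm $a_t\in\mathcal A$. Then the true context $x_t$ and the reward $y_t=f(x_t,a_t)+n_t$ are revealed, where $$x_t\in\mathcal B_\Delta(\hat x_t)=\{x\in\mathcal X:\|x-\hat x_t\|\le\Delta\}.$$ The noise is conditionally $b$-sub-Gaussian given what is determined before it is drawn: for all $\sigma\in\mathbb R$, $e^{\sigma n_t}$ is integrable and $$\mathbb E\big[e^{\sigma n_t}\mid x_1,a_1,\dots,x_t,a_t,\,y_1,\dots,y_{t-1}\big]\le e^{\sigma^2b^2/2}\quad\text{almost surely.}$$ **Algorithm.** Write $z_\tau=(x_\tau,a_\tau)$.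 For $z\in\mathcal Z$ let $\mathbf k_t(z)=(k(z,z_\tau))_{\tau<t}$, $\mathbf K_t=(k(z_\tau,z_{\tau'}))_{\tau,\tau'<t}$ (of size $(t-1)\times(t-1)$) and $\mathbf y_t=(y_\tau)_{\tau<t}$, and define $$\hat f_t(z)=\mathbf k_t(z)^\top(\mathbf K_t+\lambda\mathbf I)^{-1}\mathbf y_t,\qquad s_t^2(z)=\tfrac1\lambda k(z,z)-\tfrac1\lambda\mathbf k_t(z)^\top(\mathbf K_t+\lambda\mathbf I)^{-1}\mathbf k_t(z),$$ $$\gamma_t=\log\det(\mathbf I+\mathbf K_t/\lambda),\qquad h_t=\sqrt\lambda\,B+b\sqrt{\gamma_t-2\log\delta},\qquad U_t(z)=\hat f_t(z)+h_t\,s_t(z).$$ MaxMinUCB selects in every round an arm $a_t$ that maximizes $\inf_{x\in\mathcal B_\Delta(\hat x_t)}U_t(x,a)$ over $a\in\mathcal A$ (it is assumed that $a_t$ is such a maximizer). Let $$F_T=\sum_{t=1}^Tf(x_t,a_t),\qquad MF_t=\sup_{a\in\mathcal A}\ \inf_{x\in\mathcal B_\Delta(\hat x_t)}f(x,a)$$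 be the cumulative true reward and the oracle's optimal worst-case reward (the sup and the inf are a max and a min when attained), and let $\bar d_T$ be the rank of the kernel matrix $(k(z_\tau,z_{\tau'}))_{1\le\tau,\tau'\le T}$ of the first $T$ rounds. **Theorem.** There is an event of probability at least $1-\delta$ on which, simultaneously for all rounds $1\le T\le N$, $$F_T\ \ge\ \sum_{t=1}^TMF_t-2h_T\sqrt{2T\,\bar d_T\log\Big(1+\frac{T}{\bar d_T\lambda}\Big)},$$ where the expression under the root is read as $0$ if $\bar d_T=0$. Moreover, if $N=\infty$, then at every outcome of this event for which $(\bar d_T)_{T\ge1}$ is bounded, MaxMinUCB achieves Type-I robustness: $\sum_{t=1}^TMF_t-F_T$ is bounded above by a function $g(T)$ with $g(T)=o(T)$. -/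

import Mathlib

open MeasureTheory Asymptotics Filter
open scoped Matrix

namespace KernelBandit

noncomputable section

/-- The scalar kernel `k(z, z')` of a real RKHS `H` of real-valued functions on `Z`. -/
def scalarKernel {Z : Type*} (H : Type*) [NormedAddCommGroup H] [InnerProductSpace ℝ H]
    [CompleteSpace H] [RKHS ℝ H Z ℝ] (z z' : Z) : ℝ :=
  RKHS.kernel H z z' 1

/-- The `n × n` kernel matrix of the points `z 1, …, z n` visited in the first `n` rounds.
Rounds are numbered `1, 2, 3, …`, so that at the beginning of round `t` the data of `n = t - 1`
rounds are available. -/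
def gram {Z : Type*} (k : Z → Z → ℝ) (z : ℕ → Z) (n : ℕ) : Matrix (Fin n) (Fin n) ℝ :=
  Matrix.of fun i j => k (z (i + 1)) (z (j + 1))

/-- The vector of `k(w, z i)`, `i = 1, …, n`. -/
def kvec {Z : Type*} (k : Z → Z → ℝ) (z : ℕ → Z) (n : ℕ) (w : Z) : Fin n → ℝ :=
  fun i => k w (z (i + 1))

/-- `(K + λ I)⁻¹` for the kernel matrix `K` of the first `n` rounds. -/
def ridgeInv {Z : Type*} (k : Z → Z → ℝ) (z : ℕ → Z) (lam : ℝ) (n : ℕ) :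
    Matrix (Fin n) (Fin n) ℝ :=
  (gram k z n + lam • (1 : Matrix (Fin n) (Fin n) ℝ))⁻¹

/-- Kernel ridge regression estimate at `w` from the points `z 1, …, z n` and rewards
`y 1, …, y n`. -/
def ridgeEstimate {Z : Type*} (k : Z → Z → ℝ) (z : ℕ → Z) (y : ℕ → ℝ) (lam : ℝ) (n : ℕ)
    (w : Z) : ℝ :=
  kvec k z n w ⬝ᵥ (ridgeInv k z lam n *ᵥ fun i : Fin n => y (i + 1))

/-- The confidence width `s` at `w` from the data of `n` rounds:
`s² = (k(w,w) - kᵀ (K + λ I)⁻¹ k) / λ`. -/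
def confWidth {Z : Type*} (k : Z → Z → ℝ) (z : ℕ → Z) (lam : ℝ) (n : ℕ) (w : Z) : ℝ :=
  Real.sqrt ((1 / lam) * k w w
    - (1 / lam) * (kvec k z n w ⬝ᵥ (ridgeInv k z lam n *ᵥ kvec k z n w)))

/-- `γ = log det (I + K / λ)` for the kernel matrix `K` of the first `n` rounds. -/
def infoGain {Z : Type*} (k : Z → Z → ℝ) (z : ℕ → Z) (lam : ℝ) (n : ℕ) : ℝ :=
  Real.log ((1 : Matrix (Fin n) (Fin n) ℝ) + (1 / lam) • gram k z n).det

/-- The multiplier `h = √λ B + b √(γ - 2 log δ)` of the confidence width, from `n` rounds. -/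
def confCoeff {Z : Type*} (k : Z → Z → ℝ) (z : ℕ → Z) (lam B b δ : ℝ) (n : ℕ) : ℝ :=
  Real.sqrt lam * B + b * Real.sqrt (infoGain k z lam n - 2 * Real.log δ)

/-- The upper confidence bound `U_t(w)` of round `t`, computed from the rounds `1, …, t - 1`. -/
def ucb {Z : Type*} (k : Z → Z → ℝ) (z : ℕ → Z) (y : ℕ → ℝ) (lam B b δ : ℝ) (t : ℕ)
    (w : Z) : ℝ :=
  ridgeEstimate k z y lam (t - 1) w
    + confCoeff k z lam B b δ (t - 1) * confWidth k z lam (t - 1) w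

/-- The defense region `B_Δ(x) = {y ∈ X | ‖y - x‖ ≤ Δ}`. -/
def defenseRegion {E : Type*} [NormedAddCommGroup E] {X : Set E} (Δ : ℝ) (x : X) : Set X :=
  {y | ‖(y : E) - (x : E)‖ ≤ Δ}

/-- The worst value of the arm `a` over the contexts in `S` (the minimum, when attained). -/
def worstValue {X A : Type*} (g : X × A → ℝ) (S : Set X) (a : A) : ℝ :=
  ⨅ x : S, g (x, a)

/-- `a` maximizes the worst value over `S` among all arms. -/
def IsMaxMinArm {X A : Type*} (g : X × A → ℝ) (S : Set X) (a : A) : Prop :=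
  ∀ a' : A, worstValue g S a' ≤ worstValue g S a

/-- The optimal worst-case value over `S` (the max-min value, when attained). -/
def maxMinValue {X A : Type*} (g : X × A → ℝ) (S : Set X) : ℝ :=
  ⨆ a : A, worstValue g S a

/-- What is determined before the noise of round `t` is drawn: the true contexts and the selected
arms of the rounds `1, …, t` and the rewards of the rounds `1, …, t - 1`. -/
@[reducible] def preNoise {Ω Z : Type*} [MeasurableSpace Z] (z : ℕ → Ω → Z) (y : ℕ → Ω → ℝ)
    (t : ℕ) :
    MeasurableSpace Ω :=
  (⨆ τ ∈ Set.Icc 1 t, MeasurableSpace.comap (z τ) inferInstance) ⊔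
    ⨆ τ ∈ Set.Ico 1 t, MeasurableSpace.comap (y τ) inferInstance

/-- Type-I robustness: the cumulative optimal worst-case reward minus the cumulative true reward
is bounded above by a function that is sub-linear in the horizon `T`. -/
def TypeIRobust (worstReward reward : ℕ → ℝ) : Prop :=
  ∃ g : ℕ → ℝ, g =o[atTop] (fun T : ℕ => (T : ℝ)) ∧
    ∀ T : ℕ, ∑ t ∈ Finset.Icc 1 T, worstReward t - ∑ t ∈ Finset.Icc 1 T, reward t ≤ g T

end

end KernelBandit

/-!
The proof combines a self-normalized confidence band for kernel ridge regression with optimism.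

Write `φ w = k(·, w)` and let `γ` be the log-determinant `infoGain`. The error of the ridge estimate
at `w` is the sum of a bias, at most `√λ ‖f‖ s(w)` (`abs_inner_sub_ridgeEstimate_le`), and a linear
function of the noise, at most `s(w)` times the self-normalized norm of the noise
(`sq_ridgeEstimate_le`). Both are Cauchy–Schwarz inequalities for the splitting of `s(w)²` in
`confWidth_sq_eq`.

The squared self-normalized norm `Q` of the noise satisfies `Q ≤ b² (γ - 2 log δ)` in all rounds
simultaneously with probability `1 - δ` (`exists_event_selfNormSq_le`). The reason is that
`exp (Q / (2 b²) - γ / 2)` is a nonnegative supermartingale started at `1`, to which Ville's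
inequality applies. The recursions `selfNormSq_succ` and `infoGain_succ`, which come from the Schur
complement of the last diagonal entry of the kernel matrix, show that the ratio of successive values
is a one-dimensional Gaussian mixture of `exp (u η / b - u² / 2)`, where `η` is the new noise; hence
no Gaussian integral in `n` variables is needed
(`lintegral_mul_exp_mixture_le`).

On this event `f ≤ U ≤ f + 2 h s`. Since the chosen arm maximizes the worst value of `U`, the
max-min value of `f` is at most `U` at the visited point (`maxMinValue_le`), so the regret of a
round is at most `2 h s`. The squared widths at the visited points sum to at most `2 γ`
(`sum_sq_confWidth_le`), and `γ ≤ d log (1 + T / (d λ))` for a kernel matrix of rank `d`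
(`infoGain_le`). For bounded rank the resulting bound is of order `√T log² T`, which is sublinear.
-/

namespace KernelBandit

open ENNReal Topology RealInnerProductSpace

/-! ### Kernel ridge regression in feature space -/

section FeatureSpace

variable {Z H : Type*} [NormedAddCommGroup H] [InnerProductSpace ℝ H]
variable {k : Z → Z → ℝ} {φ : Z → H} {z : ℕ → Z} {lam : ℝ} {n : ℕ}

/-- `φ` represents the kernel `k` by inner products in a Hilbert space. All the linear algebra below
is done through such a feature map; for an RKHS it is `w ↦ k(·, w)`. -/
def IsFeatureMap (k : Z → Z → ℝ) (φ : Z → H) : Prop := ∀ w w', k w w' = ⟪φ w, φ w'⟫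

/-- The self-normalized squared norm of the noise `e 1, …, e n`:
`eᵀ K (K + λ I)⁻¹ e`, written as `eᵀ e - λ eᵀ (K + λ I)⁻¹ e`. In feature space it is
`‖∑ e i φ (z i)‖²` in the norm of `(λ I + ∑ φ (z i) ⊗ φ (z i))⁻¹`. -/
noncomputable def selfNormSq (k : Z → Z → ℝ) (z : ℕ → Z) (lam : ℝ) (n : ℕ) (e : ℕ → ℝ) : ℝ :=
  (fun i : Fin n => e (i + 1)) ⬝ᵥ (fun i : Fin n => e (i + 1))
    - lam * ((fun i : Fin n => e (i + 1)) ⬝ᵥ (ridgeInv k z lam n *ᵥ fun i : Fin n => e (i + 1)))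

/-- The combination `∑ i, c i • φ (z i)` of the first `n` feature vectors. -/
def featureSum (φ : Z → H) (z : ℕ → Z) (n : ℕ) (c : Fin n → ℝ) : H :=
  ∑ i, c i • φ (z (i + 1))

theorem inner_featureSum (hφ : IsFeatureMap k φ) (w : Z) (c : Fin n → ℝ) :
    ⟪φ w, featureSum φ z n c⟫ = kvec k z n w ⬝ᵥ c := by
  simp only [featureSum, inner_sum, inner_smul_right, dotProduct, kvec, hφ w]
  exact Finset.sum_congr rfl fun i _ => mul_comm _ _

theorem featureSum_inner_featureSum (hφ : IsFeatureMap k φ) (c d : Fin n → ℝ) :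
    ⟪featureSum φ z n c, featureSum φ z n d⟫ = c ⬝ᵥ (gram k z n *ᵥ d) := by
  rw [featureSum, sum_inner]
  simp only [inner_smul_left, inner_featureSum hφ]
  simp [dotProduct, Matrix.mulVec, gram, kvec]

theorem posSemidef_gram (hφ : IsFeatureMap k φ) : (gram k z n).PosSemidef := by
  refine Matrix.PosSemidef.of_dotProduct_mulVec_nonneg ?_ fun c => ?_
  · ext i j
    simp [gram, hφ _ _, real_inner_comm]
  · rw [star_trivial, ← featureSum_inner_featureSum hφ]
    exact real_inner_self_nonneg

theorem posDef_gram_add (hφ : IsFeatureMap k φ) (hlam : 0 < lam) :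
    (gram k z n + lam • (1 : Matrix (Fin n) (Fin n) ℝ)).PosDef :=
  Matrix.PosDef.posSemidef_add (posSemidef_gram hφ) (Matrix.PosDef.one.smul hlam)

theorem gram_mulVec_ridgeInv (hφ : IsFeatureMap k φ) (hlam : 0 < lam) (v : Fin n → ℝ) :
    gram k z n *ᵥ (ridgeInv k z lam n *ᵥ v) + lam • (ridgeInv k z lam n *ᵥ v) = v := by
  have h := (posDef_gram_add (z := z) (n := n) hφ hlam).isUnit
  have : (gram k z n + lam • (1 : Matrix (Fin n) (Fin n) ℝ)) *ᵥ (ridgeInv k z lam n *ᵥ v) = v := by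
    rw [Matrix.mulVec_mulVec, ridgeInv,
      Matrix.mul_nonsing_inv _ ((Matrix.isUnit_iff_isUnit_det _).1 h), Matrix.one_mulVec]
  rw [Matrix.add_mulVec, Matrix.smul_mulVec, Matrix.one_mulVec] at this
  exact this

theorem eq_ridgeInv_mulVec (hφ : IsFeatureMap k φ) (hlam : 0 < lam) {v c : Fin n → ℝ}
    (h : gram k z n *ᵥ c + lam • c = v) : ridgeInv k z lam n *ᵥ v = c := by
  have hu := (posDef_gram_add (z := z) (n := n) hφ hlam).isUnit
  have : (gram k z n + lam • (1 : Matrix (Fin n) (Fin n) ℝ)) *ᵥ c = v := by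
    rw [Matrix.add_mulVec, Matrix.smul_mulVec, Matrix.one_mulVec, h]
  rw [← this, Matrix.mulVec_mulVec, ridgeInv,
    Matrix.nonsing_inv_mul _ ((Matrix.isUnit_iff_isUnit_det _).1 hu), Matrix.one_mulVec]

theorem dotProduct_gram_comm (hφ : IsFeatureMap k φ) (c d : Fin n → ℝ) :
    c ⬝ᵥ (gram k z n *ᵥ d) = d ⬝ᵥ (gram k z n *ᵥ c) := by
  rw [← featureSum_inner_featureSum hφ, ← featureSum_inner_featureSum hφ, real_inner_comm]

theorem dotProduct_ridgeInv_comm (hφ : IsFeatureMap k φ) (hlam : 0 < lam) (u v : Fin n → ℝ) :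
    u ⬝ᵥ (ridgeInv k z lam n *ᵥ v) = v ⬝ᵥ (ridgeInv k z lam n *ᵥ u) := by
  have hu := gram_mulVec_ridgeInv (z := z) hφ hlam u
  have hv := gram_mulVec_ridgeInv (z := z) hφ hlam v
  set c := ridgeInv k z lam n *ᵥ u
  set d := ridgeInv k z lam n *ᵥ v
  rw [← hu, ← hv, add_dotProduct, add_dotProduct, smul_dotProduct, smul_dotProduct,
    dotProduct_comm c d, dotProduct_comm _ d, dotProduct_gram_comm hφ d c, dotProduct_comm c]

theorem dotProduct_self_nonneg_real (v : Fin n → ℝ) : 0 ≤ v ⬝ᵥ v :=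
  Finset.sum_nonneg fun i _ => mul_self_nonneg (v i)

/-- With `α = (K + λ I)⁻¹ k(w)`, the squared confidence width splits into the distance of `φ w` from
its ridge approximation `∑ α i φ (z i)` and the size of the coefficients. This is the decomposition
that makes the Cauchy–Schwarz bounds below work. -/
theorem confWidth_sq_eq (hφ : IsFeatureMap k φ) (hlam : 0 < lam) (w : Z) {α : Fin n → ℝ}
    (hα : α = ridgeInv k z lam n *ᵥ kvec k z n w) :
    (1 / lam) * k w w - (1 / lam) * (kvec k z n w ⬝ᵥ (ridgeInv k z lam n *ᵥ kvec k z n w))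
      = ‖φ w - featureSum φ z n α‖ ^ 2 / lam + α ⬝ᵥ α := by
  have h := gram_mulVec_ridgeInv (z := z) hφ hlam (kvec k z n w)
  rw [← hα] at h ⊢
  rw [norm_sub_sq_real, ← real_inner_self_eq_norm_sq, ← real_inner_self_eq_norm_sq,
    inner_featureSum hφ, featureSum_inner_featureSum hφ, hφ w w]
  have h2 : α ⬝ᵥ (gram k z n *ᵥ α) + lam * (α ⬝ᵥ α) = kvec k z n w ⬝ᵥ α := by
    rw [dotProduct_comm (kvec k z n w), ← h, dotProduct_add, dotProduct_smul, smul_eq_mul]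
  rw [← h2]
  field_simp
  ring

theorem sq_confWidth (hφ : IsFeatureMap k φ) (hlam : 0 < lam) (w : Z) :
    confWidth k z lam n w ^ 2 =
      (1 / lam) * k w w
        - (1 / lam) * (kvec k z n w ⬝ᵥ (ridgeInv k z lam n *ᵥ kvec k z n w)) := by
  rw [confWidth, Real.sq_sqrt]
  rw [confWidth_sq_eq hφ hlam w rfl]
  have := dotProduct_self_nonneg_real (ridgeInv k z lam n *ᵥ kvec k z n w)
  positivity

theorem dotProduct_ridgeInv_nonneg (hφ : IsFeatureMap k φ) (hlam : 0 < lam) (v : Fin n → ℝ) :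
    0 ≤ v ⬝ᵥ (ridgeInv k z lam n *ᵥ v) :=
  (posDef_gram_add (z := z) (n := n) hφ hlam).inv.posSemidef.dotProduct_mulVec_nonneg v

theorem confWidth_nonneg (w : Z) : 0 ≤ confWidth k z lam n w := Real.sqrt_nonneg _

theorem sq_confWidth_le (hφ : IsFeatureMap k φ) (hlam : 0 < lam) (w : Z) :
    confWidth k z lam n w ^ 2 ≤ k w w / lam := by
  rw [sq_confWidth hφ hlam]
  have := dotProduct_ridgeInv_nonneg (z := z) hφ hlam (kvec k z n w)
  have : 0 ≤ (1 / lam) * (kvec k z n w ⬝ᵥ (ridgeInv k z lam n *ᵥ kvec k z n w)) := by positivity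
  rw [one_div_mul_eq_div lam (k w w)]
  linarith

/-- Bias of kernel ridge regression on noiseless data: it is the inner product of `f` with the
residual `φ w - ∑ α i φ (z i)`. -/
theorem abs_inner_sub_ridgeEstimate_le (hφ : IsFeatureMap k φ) (hlam : 0 < lam) (f : H) (w : Z) :
    |⟪f, φ w⟫ - ridgeEstimate k z (fun t => ⟪f, φ (z t)⟫) lam n w|
      ≤ Real.sqrt lam * ‖f‖ * confWidth k z lam n w := by
  set α := ridgeInv k z lam n *ᵥ kvec k z n w with hα
  have h1 : ⟪f, φ w⟫ - ridgeEstimate k z (fun t => ⟪f, φ (z t)⟫) lam n w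
      = ⟪f, φ w - featureSum φ z n α⟫ := by
    rw [inner_sub_right, ridgeEstimate, dotProduct_ridgeInv_comm hφ hlam, ← hα]
    simp [featureSum, inner_sum, inner_smul_right, dotProduct, mul_comm]
  have h2 : ‖φ w - featureSum φ z n α‖ ≤ Real.sqrt lam * confWidth k z lam n w := by
    rw [← abs_of_nonneg (norm_nonneg _), ← abs_of_nonneg (mul_nonneg (Real.sqrt_nonneg lam)
      (confWidth_nonneg w))]
    apply sq_le_sq.1
    rw [mul_pow, Real.sq_sqrt hlam.le, sq_confWidth hφ hlam, confWidth_sq_eq hφ hlam w hα]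
    have : 0 ≤ α ⬝ᵥ α := dotProduct_self_nonneg_real _
    field_simp
    nlinarith
  rw [h1]
  calc _ ≤ ‖f‖ * ‖φ w - featureSum φ z n α‖ := abs_real_inner_le_norm _ _
    _ ≤ ‖f‖ * (Real.sqrt lam * confWidth k z lam n w) := by gcongr
    _ = _ := by ring

/-- The splitting of `selfNormSq` dual to that of the squared confidence width. -/
theorem selfNormSq_eq (hφ : IsFeatureMap k φ) (hlam : 0 < lam) (e : ℕ → ℝ) {c : Fin n → ℝ}
    (hc : c = ridgeInv k z lam n *ᵥ fun i : Fin n => e (i + 1)) :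
    selfNormSq k z lam n e = (gram k z n *ᵥ c) ⬝ᵥ (gram k z n *ᵥ c)
      + lam * ‖featureSum φ z n c‖ ^ 2 := by
  have h := gram_mulVec_ridgeInv (z := z) hφ hlam (fun i : Fin n => e (i + 1))
  rw [selfNormSq, ← hc] at *
  rw [← real_inner_self_eq_norm_sq, featureSum_inner_featureSum hφ, ← h]
  simp only [add_dotProduct, dotProduct_add, smul_dotProduct, dotProduct_smul, smul_eq_mul]
  rw [dotProduct_comm _ c]
  ring

/-- The contribution of the noise to the ridge estimate, by Cauchy–Schwarz in `H × ℝⁿ` for the pairs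
of `confWidth_sq_eq` and `selfNormSq_eq`. -/
theorem sq_ridgeEstimate_le (hφ : IsFeatureMap k φ) (hlam : 0 < lam) (e : ℕ → ℝ) (w : Z) :
    ridgeEstimate k z e lam n w ^ 2 ≤ confWidth k z lam n w ^ 2 * selfNormSq k z lam n e := by
  set c := ridgeInv k z lam n *ᵥ fun i : Fin n => e (i + 1) with hc
  set α := ridgeInv k z lam n *ᵥ kvec k z n w with hα
  rw [selfNormSq_eq hφ hlam e hc, sq_confWidth hφ hlam, confWidth_sq_eq hφ hlam w hα]
  set u := φ w - featureSum φ z n α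
  set g := featureSum φ z n c
  have h1 : ridgeEstimate k z e lam n w = ⟪u, g⟫ + α ⬝ᵥ (gram k z n *ᵥ c) := by
    rw [inner_sub_left, featureSum_inner_featureSum hφ, inner_featureSum hφ, ridgeEstimate]
    ring
  have h2 : |⟪u, g⟫| ≤ ‖u‖ * ‖g‖ := abs_real_inner_le_norm _ _
  have h3 : (α ⬝ᵥ (gram k z n *ᵥ c)) ^ 2 ≤
      (α ⬝ᵥ α) * ((gram k z n *ᵥ c) ⬝ᵥ (gram k z n *ᵥ c)) := by
    simpa [dotProduct, sq] using
      Finset.sum_mul_sq_le_sq_mul_sq Finset.univ α (gram k z n *ᵥ c)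
  rw [h1]
  set p := ⟪u, g⟫
  set q := α ⬝ᵥ (gram k z n *ᵥ c)
  have ha : 0 ≤ α ⬝ᵥ α := dotProduct_self_nonneg_real _
  have hb : 0 ≤ (gram k z n *ᵥ c) ⬝ᵥ (gram k z n *ᵥ c) :=
    dotProduct_self_nonneg_real _
  set a := α ⬝ᵥ α
  set b := (gram k z n *ᵥ c) ⬝ᵥ (gram k z n *ᵥ c)
  have hp : p ^ 2 ≤ ‖u‖ ^ 2 * ‖g‖ ^ 2 := by
    rw [← mul_pow, ← sq_abs p]; gcongr
  -- The mixed term of `(p + q)²`, by AM-GM.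
  have hpq : 2 * p * q ≤ ‖u‖ ^ 2 / lam * b + a * (lam * ‖g‖ ^ 2) := by
    have h4 : (p * q) ^ 2 ≤ (‖u‖ ^ 2 / lam * b) * (a * (lam * ‖g‖ ^ 2)) := by
      calc (p * q) ^ 2 = p ^ 2 * q ^ 2 := by ring
        _ ≤ (‖u‖ ^ 2 * ‖g‖ ^ 2) * (a * b) := by gcongr
        _ = _ := by field_simp
    have h5 : 0 ≤ ‖u‖ ^ 2 / lam * b := by positivity
    have h6 : 0 ≤ a * (lam * ‖g‖ ^ 2) := by positivity
    have : (2 * p * q) ^ 2 ≤ (‖u‖ ^ 2 / lam * b + a * (lam * ‖g‖ ^ 2)) ^ 2 := by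
      nlinarith [sq_nonneg (‖u‖ ^ 2 / lam * b - a * (lam * ‖g‖ ^ 2))]
    exact le_of_abs_le (abs_le_of_sq_le_sq this (by positivity))
  have : (‖u‖ ^ 2 / lam + a) * (b + lam * ‖g‖ ^ 2) =
      ‖u‖ ^ 2 * ‖g‖ ^ 2 + a * b + (‖u‖ ^ 2 / lam * b + a * (lam * ‖g‖ ^ 2)) := by
    field_simp; ring
  rw [this]
  nlinarith

/-! ### Adding a point, log-determinants and rank -/

/-- Schur complement of the last diagonal entry. -/
theorem det_gram_succ (hφ : IsFeatureMap k φ) (hlam : 0 < lam) :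
    (gram k z (n + 1) + lam • (1 : Matrix (Fin (n + 1)) (Fin (n + 1)) ℝ)).det
      = (gram k z n + lam • (1 : Matrix (Fin n) (Fin n) ℝ)).det
        * (lam * (1 + confWidth k z lam n (z (n + 1)) ^ 2)) := by
  have hblock : (gram k z (n + 1) + lam • (1 : Matrix (Fin (n + 1)) (Fin (n + 1)) ℝ)).submatrix
      (finSumFinEquiv : Fin n ⊕ Fin 1 ≃ Fin (n + 1)) (finSumFinEquiv : Fin n ⊕ Fin 1 ≃ Fin (n + 1))
      = Matrix.fromBlocks (gram k z n + lam • (1 : Matrix (Fin n) (Fin n) ℝ))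
        (Matrix.of fun i _ => kvec k z n (z (n + 1)) i)
        (Matrix.of fun _ j => kvec k z n (z (n + 1)) j)
        (Matrix.of fun _ _ => k (z (n + 1)) (z (n + 1)) + lam) := by
    ext i j
    rcases i with i | i <;> rcases j with j | j
    · simp [gram, Matrix.one_apply, Fin.ext_iff]
    · have h : (i : ℕ) ≠ n := i.2.ne
      simp [gram, Fin.ext_iff, kvec, hφ _ _, real_inner_comm, h]
    · have h : n ≠ (j : ℕ) := j.2.ne'
      simp [gram, Fin.ext_iff, kvec, h]
    · simp [gram, Matrix.one_apply, Fin.ext_iff]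
  have hu := (Matrix.isUnit_iff_isUnit_det _).1
    (posDef_gram_add (z := z) (n := n) hφ hlam).isUnit
  let _ := Matrix.invertibleOfIsUnitDet _ hu
  rw [← Matrix.det_submatrix_equiv_self (finSumFinEquiv : Fin n ⊕ Fin 1 ≃ Fin (n + 1)), hblock,
    Matrix.det_fromBlocks₁₁, sq_confWidth hφ hlam, Matrix.invOf_eq_nonsing_inv]
  congr 1
  rw [Matrix.det_unique]
  have h : ((Matrix.of fun (_ : Fin 1) j => kvec k z n (z (n + 1)) j)
      * (gram k z n + lam • (1 : Matrix (Fin n) (Fin n) ℝ))⁻¹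
      * (Matrix.of fun i (_ : Fin 1) => kvec k z n (z (n + 1)) i)) default default
      = kvec k z n (z (n + 1)) ⬝ᵥ (ridgeInv k z lam n *ᵥ kvec k z n (z (n + 1))) := by
    rw [Matrix.mul_assoc]; rfl
  rw [Matrix.sub_apply, h]
  simp only [Matrix.of_apply]
  field_simp
  ring

theorem det_one_add_gram (hlam : 0 < lam) :
    ((1 : Matrix (Fin n) (Fin n) ℝ) + (1 / lam) • gram k z n).det
      = (gram k z n + lam • (1 : Matrix (Fin n) (Fin n) ℝ)).det / lam ^ n := by
  have : (1 : Matrix (Fin n) (Fin n) ℝ) + (1 / lam) • gram k z n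
      = (1 / lam) • (gram k z n + lam • (1 : Matrix (Fin n) (Fin n) ℝ)) := by
    rw [smul_add, smul_smul, one_div_mul_cancel hlam.ne', one_smul, add_comm]
  rw [this, Matrix.det_smul, Fintype.card_fin, one_div, inv_pow, inv_mul_eq_div]

theorem infoGain_zero : infoGain k z lam 0 = 0 := by simp [infoGain]

theorem infoGain_succ (hφ : IsFeatureMap k φ) (hlam : 0 < lam) :
    infoGain k z lam (n + 1)
      = infoGain k z lam n + Real.log (1 + confWidth k z lam n (z (n + 1)) ^ 2) := by
  have h1 := (posDef_gram_add (z := z) (n := n) hφ hlam).det_pos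
  rw [infoGain, infoGain, det_one_add_gram hlam, det_one_add_gram hlam, det_gram_succ hφ hlam,
    ← Real.log_mul (by positivity) (by positivity)]
  congr 1
  field_simp
  ring

theorem infoGain_eq_sum (hφ : IsFeatureMap k φ) (hlam : 0 < lam) (n : ℕ) :
    infoGain k z lam n
      = ∑ t ∈ Finset.range n, Real.log (1 + confWidth k z lam t (z (t + 1)) ^ 2) := by
  induction n with
  | zero => simp [infoGain_zero]
  | succ n ih => rw [infoGain_succ hφ hlam, Finset.sum_range_succ, ih]

theorem monotone_infoGain (hφ : IsFeatureMap k φ) (hlam : 0 < lam) :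
    Monotone (infoGain k z lam) := by
  refine monotone_nat_of_le_succ fun n => ?_
  rw [infoGain_succ hφ hlam]
  have := Real.log_nonneg (x := 1 + confWidth k z lam n (z (n + 1)) ^ 2)
    (le_add_of_nonneg_right (sq_nonneg _))
  linarith

theorem selfNormSq_zero (e : ℕ → ℝ) : selfNormSq k z lam 0 e = 0 := by
  simp [selfNormSq, dotProduct]

/-- Effect of one more round on `selfNormSq`, in terms of the squared width `r` and the prediction
`μ` of the new noise from the previous noises. -/
theorem selfNormSq_succ (hφ : IsFeatureMap k φ) (hlam : 0 < lam) (e : ℕ → ℝ) {r μ : ℝ}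
    (hr : r = confWidth k z lam n (z (n + 1)) ^ 2)
    (hμ : μ = ridgeEstimate k z e lam n (z (n + 1))) :
    selfNormSq k z lam (n + 1) e = selfNormSq k z lam n e
      + (r * e (n + 1) ^ 2 + 2 * e (n + 1) * μ - μ ^ 2) / (1 + r) := by
  have hr0 : 0 ≤ r := hr ▸ sq_nonneg _
  set v : Fin n → ℝ := kvec k z n (z (n + 1)) with hv
  set en : Fin n → ℝ := fun i => e (i + 1) with hen
  set c := ridgeInv k z lam n *ᵥ en with hc
  set α := ridgeInv k z lam n *ᵥ v with hα
  -- Block elimination: the new coefficient is `β`, and the old coefficients are corrected by `β α`.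
  set β := (e (n + 1) - μ) / (lam * (1 + r)) with hβ
  have hcs := gram_mulVec_ridgeInv (z := z) hφ hlam en
  have hαs := gram_mulVec_ridgeInv (z := z) hφ hlam v
  rw [← hc] at hcs
  rw [← hα] at hαs
  rw [sq_confWidth hφ hlam, ← hv, ← hα] at hr
  have hμ' : v ⬝ᵥ c = μ := hμ.symm
  have hr' : k (z (n + 1)) (z (n + 1)) = lam * r + v ⬝ᵥ α := by
    rw [hr]; field_simp; ring
  have hβ' : β * (lam * (1 + r)) = e (n + 1) - μ := by rw [hβ]; field_simp
  have hsol : ridgeInv k z lam (n + 1) *ᵥ (fun i : Fin (n + 1) => e (i + 1))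
      = Fin.snoc (c - β • α) β := by
    refine eq_ridgeInv_mulVec hφ hlam (funext fun i => ?_)
    refine Fin.lastCases ?_ (fun i => ?_) i
    · have : (gram k z (n + 1) *ᵥ (Fin.snoc (c - β • α) β : Fin (n + 1) → ℝ)) (Fin.last n)
          = v ⬝ᵥ (c - β • α) + k (z (n + 1)) (z (n + 1)) * β := by
        simp [Matrix.mulVec, dotProduct, Fin.sum_univ_castSucc, gram, hv, kvec]
      rw [Pi.add_apply, this, hr', dotProduct_sub, dotProduct_smul, hμ']
      simp
      linarith
    · have : (gram k z (n + 1) *ᵥ (Fin.snoc (c - β • α) β : Fin (n + 1) → ℝ)) i.castSucc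
          = (gram k z n *ᵥ (c - β • α)) i + v i * β := by
        simp [Matrix.mulVec, dotProduct, Fin.sum_univ_castSucc, gram, hv, kvec, hφ _ _,
          real_inner_comm]
      have h1 := congrFun hcs i
      have h2 := congrFun hαs i
      rw [Pi.add_apply, this, Matrix.mulVec_sub, Matrix.mulVec_smul]
      simp at h1 h2 ⊢
      rw [← h2]
      have h3 : e (i + 1) = en i := rfl
      rw [h3, ← h1]
      ring
  have hq : (fun i : Fin (n + 1) => e (i + 1)) ⬝ᵥ (Fin.snoc (c - β • α) β : Fin (n + 1) → ℝ)
      = en ⬝ᵥ c - β * μ + e (n + 1) * β := by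
    have : en ⬝ᵥ α = μ := by rw [← hμ', hα, hc, dotProduct_ridgeInv_comm hφ hlam]
    rw [← this]
    simp [dotProduct, Fin.sum_univ_castSucc, hen, mul_sub, Finset.sum_sub_distrib, Finset.mul_sum]
    exact Finset.sum_congr rfl fun i _ => by ring
  have hn : (fun i : Fin (n + 1) => e (i + 1)) ⬝ᵥ (fun i : Fin (n + 1) => e (i + 1))
      = en ⬝ᵥ en + e (n + 1) ^ 2 := by
    simp [dotProduct, Fin.sum_univ_castSucc, hen, sq]
  rw [selfNormSq, hsol, hq, hn, selfNormSq, ← hen, ← hc, hβ]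
  field_simp
  ring

/-- The log-determinant is a sum of `d` values `log (1 + e / λ)` over the nonzero eigenvalues `e`,
whose sum is at most the trace and so at most `n`; concavity of the logarithm does the rest. -/
theorem infoGain_le (hφ : IsFeatureMap k φ) (hlam : 0 < lam) (hk : ∀ w, k w w ≤ 1) {d : ℕ}
    (hd : d = (gram k z n).rank) :
    infoGain k z lam n ≤ d * Real.log (1 + n / (d * lam)) := by
  have hps := posSemidef_gram (z := z) (n := n) hφ
  have hH := hps.1
  have he := hps.eigenvalues_nonneg
  have htr : ∑ i, hH.eigenvalues i ≤ n := by
    have h := hH.trace_eq_sum_eigenvalues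
    simp only [RCLike.ofReal_real_eq_id, id] at h
    rw [← h, Matrix.trace]
    calc _ ≤ ∑ _i : Fin n, (1 : ℝ) := Finset.sum_le_sum fun i _ => hk _
      _ = n := by simp
  have hdet : ((1 : Matrix (Fin n) (Fin n) ℝ) + (1 / lam) • gram k z n).det
      = ∏ i, (1 + hH.eigenvalues i / lam) := by
    -- `det (I + K / λ)` is, up to sign and scale, the characteristic polynomial of `K` at `-λ`.
    have h := Matrix.eval_charpoly (gram k z n) (-lam)
    rw [hH.charpoly_eq, Polynomial.eval_prod] at h
    have h2 : (1 : Matrix (Fin n) (Fin n) ℝ) + (1 / lam) • gram k z n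
        = (-(1 / lam)) • (Matrix.scalar (Fin n) (-lam) - gram k z n) := by
      rw [smul_sub, Matrix.scalar_apply, ← Matrix.smul_one_eq_diagonal, smul_smul, neg_mul_neg,
        one_div_mul_cancel hlam.ne', one_smul, neg_smul, sub_neg_eq_add]
    rw [h2, Matrix.det_smul, ← h, Fintype.card_fin]
    have : (-(1 / lam)) ^ n = ∏ _i : Fin n, (-(1 / lam)) := by simp
    rw [this, ← Finset.prod_mul_distrib]
    refine Finset.prod_congr rfl fun i _ => ?_
    simp
    field_simp
    ring
  set S : Finset (Fin n) := Finset.univ.filter fun i => hH.eigenvalues i ≠ 0 with hS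
  have hcard : d = S.card := by
    rw [hd, hH.rank_eq_card_non_zero_eigs, Fintype.card_subtype]
  rcases Nat.eq_zero_or_pos d with hd0 | hdpos
  · have hz : ∀ i, hH.eigenvalues i = 0 := by
      intro i
      by_contra hi
      have : i ∈ S := by simp [hS, hi]
      rw [hd0] at hcard
      simp [Finset.card_eq_zero.1 hcard.symm] at this
    rw [infoGain, hdet]
    simp [hz, hd0]
  have hdR : (0 : ℝ) < d := by exact_mod_cast hdpos
  set c : ℝ := 1 + n / (d * lam) with hc
  have hcpos : 0 < c := by positivity
  -- The tangent of the logarithm at the average `c` replaces Jensen's inequality.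
  have hlog : ∀ i, Real.log (1 + hH.eigenvalues i / lam)
      ≤ (1 + hH.eigenvalues i / lam) / c - 1 + Real.log c := by
    intro i
    have hpos : 0 < 1 + hH.eigenvalues i / lam := by have := he i; positivity
    have := Real.log_le_sub_one_of_pos (div_pos hpos hcpos)
    rw [Real.log_div hpos.ne' hcpos.ne'] at this
    linarith
  have hsum : ∑ i, Real.log (1 + hH.eigenvalues i / lam)
      = ∑ i ∈ S, Real.log (1 + hH.eigenvalues i / lam) := by
    symm
    apply Finset.sum_subset (Finset.subset_univ _)
    intro i _ hi
    have : hH.eigenvalues i = 0 := by simpa [hS] using hi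
    simp [this]
  have hS2 : ∑ i ∈ S, hH.eigenvalues i ≤ n :=
    (Finset.sum_le_sum_of_subset_of_nonneg (Finset.subset_univ _) fun i _ _ => he i).trans htr
  rw [infoGain, hdet, Real.log_prod (fun i _ => by have := he i; positivity), hsum]
  refine (Finset.sum_le_sum fun i _ => hlog i).trans ?_
  rw [Finset.sum_add_distrib, Finset.sum_sub_distrib, ← Finset.sum_div, Finset.sum_add_distrib,
    ← Finset.sum_div]
  simp only [Finset.sum_const, nsmul_eq_mul, ← hcard, mul_one]
  have h1 : (d + (∑ i ∈ S, hH.eigenvalues i) / lam) / c ≤ d := by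
    rw [div_le_iff₀ hcpos, hc, mul_add, mul_one]
    have : (d : ℝ) * (n / (d * lam)) = n / lam := by field_simp
    rw [this]
    gcongr
  linarith

/-- Elliptical potential lemma: the squared widths `r` at the visited points are at most `1`, where
`r ≤ 2 log (1 + r)`. -/
theorem sum_sq_confWidth_le (hφ : IsFeatureMap k φ) (hlam : 1 ≤ lam) (hk : ∀ w, k w w ≤ 1)
    (n : ℕ) :
    ∑ t ∈ Finset.range n, confWidth k z lam t (z (t + 1)) ^ 2 ≤ 2 * infoGain k z lam n := by
  have hl : 0 < lam := by linarith
  rw [infoGain_eq_sum hφ hl, Finset.mul_sum]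
  refine Finset.sum_le_sum fun t _ => ?_
  have h1 : confWidth k z lam t (z (t + 1)) ^ 2 ≤ 1 :=
    (sq_confWidth_le hφ hl _).trans ((div_le_one hl).2 ((hk _).trans hlam))
  have h0 := sq_nonneg (confWidth k z lam t (z (t + 1)))
  set r := confWidth k z lam t (z (t + 1)) ^ 2
  have h2 := Real.one_sub_inv_le_log_of_pos (x := 1 + r) (by positivity)
  have h3 : r / 2 ≤ 1 - (1 + r)⁻¹ := by
    rw [inv_eq_one_div, le_sub_iff_add_le, ← le_sub_iff_add_le', div_le_iff₀ (by positivity)]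
    nlinarith
  linarith

end FeatureSpace

/-! ### Gaussian mixtures and maximal inequalities -/

section Supermartingale

/-- A Gaussian mixture with mean `m` and variance `r` of the exponentials `exp (u ν - u² / 2)` in
closed form, by completing the square. The mixing variable is `u = m + √r g` with `g` standard
normal, which includes `r = 0`. -/
theorem lintegral_exp_mixture {r : ℝ} (hr : 0 ≤ r) (m ν : ℝ) :
    ∫⁻ g : ℝ, ENNReal.ofReal (Real.exp (-g ^ 2 / 2) / Real.sqrt (2 * Real.pi))
        * ENNReal.ofReal (Real.exp ((m + Real.sqrt r * g) * ν - (m + Real.sqrt r * g) ^ 2 / 2))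
      = ENNReal.ofReal (Real.exp ((r * ν ^ 2 + 2 * ν * m - m ^ 2) / (2 * (1 + r)))
          / Real.sqrt (1 + r)) := by
  have h1r : 0 < 1 + r := by positivity
  set g₀ := Real.sqrt r * (ν - m) / (1 + r) with hg₀
  set q := (r * ν ^ 2 + 2 * ν * m - m ^ 2) / (2 * (1 + r)) with hq
  have hexp : ∀ g : ℝ, ENNReal.ofReal (Real.exp (-g ^ 2 / 2) / Real.sqrt (2 * Real.pi))
        * ENNReal.ofReal (Real.exp ((m + Real.sqrt r * g) * ν - (m + Real.sqrt r * g) ^ 2 / 2))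
      = ENNReal.ofReal (Real.exp q / Real.sqrt (2 * Real.pi)
          * Real.exp (-((1 + r) / 2) * (g - g₀) ^ 2)) := by
    intro g
    rw [← ENNReal.ofReal_mul (by positivity), div_mul_eq_mul_div, ← Real.exp_add,
      div_mul_eq_mul_div, ← Real.exp_add]
    congr 3
    have hs : Real.sqrt r ^ 2 = r := Real.sq_sqrt hr
    have hg : (1 + r) * g₀ = Real.sqrt r * (ν - m) := by rw [hg₀]; field_simp
    have hg2 : (1 + r) * g₀ ^ 2 = r * (ν - m) ^ 2 / (1 + r) := by
      rw [hg₀, div_pow, mul_pow, hs]; field_simp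
    have hq2 : q = r * (ν - m) ^ 2 / (1 + r) / 2 + m * ν - m ^ 2 / 2 := by
      rw [hq]; field_simp; ring
    rw [hq2, ← hg2]
    linear_combination (-(1 / 2) * g ^ 2) * hs - g * hg
  simp_rw [hexp]
  have hint : Integrable fun g : ℝ => Real.exp (-((1 + r) / 2) * (g - g₀) ^ 2) :=
    (integrable_exp_neg_mul_sq (by positivity : 0 < (1 + r) / 2)).comp_sub_right g₀
  rw [← ofReal_integral_eq_lintegral_ofReal (hint.const_mul _)
    (Eventually.of_forall fun g => by positivity), integral_const_mul,
    integral_sub_right_eq_self (fun g : ℝ => Real.exp (-((1 + r) / 2) * g ^ 2)) g₀,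
    integral_gaussian]
  congr 1
  have : Real.pi / ((1 + r) / 2) = 2 * Real.pi / (1 + r) := by field_simp
  rw [this, Real.sqrt_div (by positivity)]
  have : Real.sqrt (2 * Real.pi) ≠ 0 := by positivity
  field_simp

variable {Ω : Type*} {m m0 : MeasurableSpace Ω} {P : Measure Ω}

/-- A conditional bound `E[exp (σ η) | m] ≤ exp c` in unconditional form, tested against
`m`-measurable weights `W`. -/
theorem lintegral_mul_exp_le_of_condExp_le [IsFiniteMeasure P] (hm : m ≤ m0)
    {η : Ω → ℝ} (hη : Measurable η) {σ c : ℝ}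
    (hint : Integrable (fun ω => Real.exp (σ * η ω)) P)
    (hle : P[fun ω => Real.exp (σ * η ω) | m] ≤ᵐ[P] fun _ => Real.exp c)
    {W : Ω → ℝ≥0∞} (hW : Measurable[m] W) :
    ∫⁻ ω, W ω * ENNReal.ofReal (Real.exp (σ * η ω - c)) ∂P ≤ ∫⁻ ω, W ω ∂P := by
  have he : Measurable fun ω => ENNReal.ofReal (Real.exp (σ * η ω - c)) := by fun_prop
  have hmeas : (P.withDensity fun ω => ENNReal.ofReal (Real.exp (σ * η ω - c))).trim hm
      ≤ P.trim hm := by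
    refine Measure.le_iff.2 fun s hs => ?_
    rw [trim_measurableSet_eq hm hs, trim_measurableSet_eq hm hs, withDensity_apply _ (hm s hs)]
    have hi : Integrable (fun ω => Real.exp (σ * η ω - c)) P := by
      simpa [Real.exp_sub] using hint.div_const (Real.exp c)
    rw [← ofReal_integral_eq_lintegral_ofReal hi.integrableOn
      (Eventually.of_forall fun ω => (Real.exp_pos _).le)]
    refine ENNReal.ofReal_le_of_le_toReal ?_
    have h1 : ∫ ω in s, Real.exp (σ * η ω - c) ∂P
        = (∫ ω in s, Real.exp (σ * η ω) ∂P) / Real.exp c := by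
      simp_rw [Real.exp_sub, integral_div]
    rw [h1, div_le_iff₀ (Real.exp_pos _), ← setIntegral_condExp hm hint hs]
    calc _ ≤ ∫ _ω in s, Real.exp c ∂P :=
          setIntegral_mono_ae integrable_condExp.integrableOn (integrable_const _).integrableOn hle
      _ = _ := by simp [measureReal_def]
  calc _ = ∫⁻ ω, W ω ∂(P.withDensity fun ω => ENNReal.ofReal (Real.exp (σ * η ω - c))) := by
        rw [lintegral_withDensity_eq_lintegral_mul _ he (hW.mono hm le_rfl)]
        simp [mul_comm]
    _ = ∫⁻ ω, W ω ∂((P.withDensity fun ω => ENNReal.ofReal (Real.exp (σ * η ω - c))).trim hm) :=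
        (lintegral_trim hm hW).symm
    _ ≤ ∫⁻ ω, W ω ∂(P.trim hm) := lintegral_mono' hmeas le_rfl
    _ = _ := lintegral_trim hm hW

/-- The sub-Gaussian bound holds with an `m`-measurable random parameter `U` in place of a constant:
for finitely many values by splitting the space, in general by approximation and Fatou's lemma. -/
theorem lintegral_mul_exp_le_of_subGaussian [IsFiniteMeasure P] (hm : m ≤ m0)
    {η : Ω → ℝ} (hη : Measurable η) {b : ℝ}
    (hint : ∀ σ : ℝ, Integrable (fun ω => Real.exp (σ * η ω)) P)
    (hle : ∀ σ : ℝ, P[fun ω => Real.exp (σ * η ω) | m] ≤ᵐ[P] fun _ => Real.exp (σ ^ 2 * b ^ 2 / 2))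
    {W : Ω → ℝ≥0∞} (hW : Measurable[m] W) {U : Ω → ℝ} (hU : Measurable[m] U) :
    ∫⁻ ω, W ω * ENNReal.ofReal (Real.exp (U ω * η ω - U ω ^ 2 * b ^ 2 / 2)) ∂P
      ≤ ∫⁻ ω, W ω ∂P := by
  have hsimple : ∀ V : Ω → ℝ, Measurable[m] V → (Set.range V).Finite →
      ∫⁻ ω, W ω * ENNReal.ofReal (Real.exp (V ω * η ω - V ω ^ 2 * b ^ 2 / 2)) ∂P
        ≤ ∫⁻ ω, W ω ∂P := by
    intro V hV hfin
    have hpart : ∀ F : Ω → ℝ≥0∞, ∀ ω,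
        F ω = ∑ v ∈ hfin.toFinset, (V ⁻¹' {v}).indicator F ω := by
      intro F ω
      rw [Finset.sum_eq_single (V ω)]
      · simp
      · intro v _ hv
        exact Set.indicator_of_notMem (by simpa using hv.symm) _
      · intro h; exact absurd (by simp) h
    have hWm : Measurable W := hW.mono hm le_rfl
    have hVm : ∀ v, MeasurableSet (V ⁻¹' {v}) := fun v => hm _ (hV (measurableSet_singleton v))
    have hVmeas : Measurable V := hV.mono hm le_rfl
    rw [lintegral_congr (hpart W), lintegral_congr (hpart fun ω => W ω *
        ENNReal.ofReal (Real.exp (V ω * η ω - V ω ^ 2 * b ^ 2 / 2))),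
      lintegral_finsetSum _ fun v _ => Measurable.indicator (by fun_prop) (hVm v),
      lintegral_finsetSum _ fun v _ => hWm.indicator (hVm v)]
    refine Finset.sum_le_sum fun v _ => ?_
    have h := lintegral_mul_exp_le_of_condExp_le hm hη (hint v) (hle v)
      (hW.indicator (hV (measurableSet_singleton v)))
    refine le_trans (lintegral_mono fun ω => ?_) h
    by_cases hω : ω ∈ V ⁻¹' {v}
    · have : V ω = v := hω
      simp [this]
    · simp [Set.indicator_of_notMem hω]
  let V : ℕ → Ω → ℝ := fun i => StronglyMeasurable.approx hU.stronglyMeasurable i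
  have hV : ∀ i, Measurable[m] (V i) := fun i => @SimpleFunc.measurable _ _ m _ _
  have hVfin : ∀ i, (Set.range (V i)).Finite := fun i => @SimpleFunc.finite_range _ _ m _
  have hlim : ∀ ω, Tendsto (fun i => V i ω) atTop (𝓝 (U ω)) :=
    fun ω => StronglyMeasurable.tendsto_approx hU.stronglyMeasurable ω
  have hlim2 : ∀ ω, W ω * ENNReal.ofReal (Real.exp (U ω * η ω - U ω ^ 2 * b ^ 2 / 2))
      ≤ liminf (fun i => W ω *
        ENNReal.ofReal (Real.exp (V i ω * η ω - V i ω ^ 2 * b ^ 2 / 2))) atTop := by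
    intro ω
    refine (Tendsto.liminf_eq ?_).ge
    refine ENNReal.Tendsto.const_mul (ENNReal.tendsto_ofReal ?_) (Or.inl ?_)
    · have hc : Continuous fun u : ℝ => Real.exp (u * η ω - u ^ 2 * b ^ 2 / 2) := by fun_prop
      exact (hc.tendsto _).comp (hlim ω)
    · simp [Real.exp_pos]
  refine (lintegral_mono hlim2).trans ((lintegral_liminf_le fun i => ?_).trans ?_)
  · have hVmeas : Measurable (V i) := (hV i).mono hm le_rfl
    have hWm : Measurable W := hW.mono hm le_rfl
    fun_prop
  · exact liminf_le_of_le (by isBoundedDefault) fun c hc => by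
      obtain ⟨i, hi⟩ := hc.exists
      exact hi.trans (hsimple (V i) (hV i) (hVfin i))

/-- One step of the method of mixtures: `lintegral_mul_exp_le_of_subGaussian` with the parameter
`U = (μ / b + √r g) / b`, averaged over a standard normal `g`. -/
theorem lintegral_mul_exp_mixture_le [IsFiniteMeasure P] (hm : m ≤ m0)
    {η : Ω → ℝ} (hη : Measurable η) {b : ℝ} (hb : 0 < b)
    (hint : ∀ σ : ℝ, Integrable (fun ω => Real.exp (σ * η ω)) P)
    (hle : ∀ σ : ℝ, P[fun ω => Real.exp (σ * η ω) | m] ≤ᵐ[P] fun _ => Real.exp (σ ^ 2 * b ^ 2 / 2))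
    {W : Ω → ℝ≥0∞} (hW : Measurable[m] W) {r μ : Ω → ℝ} (hr : Measurable[m] r)
    (hμ : Measurable[m] μ) (hr0 : ∀ ω, 0 ≤ r ω) :
    ∫⁻ ω, W ω * ENNReal.ofReal (Real.exp ((r ω * η ω ^ 2 + 2 * η ω * μ ω - μ ω ^ 2)
        / (1 + r ω) / (2 * b ^ 2)) / Real.sqrt (1 + r ω)) ∂P ≤ ∫⁻ ω, W ω ∂P := by
  have hWm : Measurable W := hW.mono hm le_rfl
  have hrm : Measurable r := hr.mono hm le_rfl
  have hμm : Measurable μ := hμ.mono hm le_rfl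
  have hmix : ∀ ω, W ω * ENNReal.ofReal (Real.exp ((r ω * η ω ^ 2 + 2 * η ω * μ ω - μ ω ^ 2)
        / (1 + r ω) / (2 * b ^ 2)) / Real.sqrt (1 + r ω))
      = ∫⁻ g : ℝ, ENNReal.ofReal (Real.exp (-g ^ 2 / 2) / Real.sqrt (2 * Real.pi))
        * (W ω * ENNReal.ofReal (Real.exp (((μ ω / b + Real.sqrt (r ω) * g) / b) * η ω
          - ((μ ω / b + Real.sqrt (r ω) * g) / b) ^ 2 * b ^ 2 / 2))) := by
    intro ω
    have h := lintegral_exp_mixture (hr0 ω) (μ ω / b) (η ω / b)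
    have hq : (r ω * η ω ^ 2 + 2 * η ω * μ ω - μ ω ^ 2) / (1 + r ω) / (2 * b ^ 2)
        = (r ω * (η ω / b) ^ 2 + 2 * (η ω / b) * (μ ω / b) - (μ ω / b) ^ 2) / (2 * (1 + r ω)) := by
      have := hr0 ω
      field_simp
    rw [hq, ← h, ← lintegral_const_mul _ (by fun_prop)]
    refine lintegral_congr fun g => ?_
    rw [mul_left_comm]
    congr 4
    field_simp
  simp_rw [hmix]
  rw [lintegral_lintegral_swap (by fun_prop)]
  have hstep : ∀ g : ℝ,
      ∫⁻ ω, ENNReal.ofReal (Real.exp (-g ^ 2 / 2) / Real.sqrt (2 * Real.pi))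
        * (W ω * ENNReal.ofReal (Real.exp (((μ ω / b + Real.sqrt (r ω) * g) / b) * η ω
          - ((μ ω / b + Real.sqrt (r ω) * g) / b) ^ 2 * b ^ 2 / 2))) ∂P
      ≤ ENNReal.ofReal (Real.exp (-g ^ 2 / 2) / Real.sqrt (2 * Real.pi)) * ∫⁻ ω, W ω ∂P := by
    intro g
    rw [lintegral_const_mul _ (by fun_prop)]
    refine mul_le_mul' le_rfl ?_
    exact lintegral_mul_exp_le_of_subGaussian hm hη hint hle hW
      (U := fun ω => (μ ω / b + Real.sqrt (r ω) * g) / b)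
      (((hμ.div_const b).add (hr.sqrt.mul_const g)).div_const b)
  refine (lintegral_mono hstep).trans ?_
  rw [lintegral_mul_const _ (by fun_prop)]
  have h0 := lintegral_exp_mixture le_rfl 0 0
  simp at h0
  simp [h0]

/-- Ville's maximal inequality on a finite horizon. The supermartingale property is needed only on
the events that `M` has not exceeded `c` so far. -/
theorem measure_exists_lt_le_of_supermartingale {M : ℕ → Ω → ℝ≥0∞} {T : ℕ} {c : ℝ≥0∞}
    (hmeas : ∀ t ≤ T, Measurable (M t))
    (h0 : ∫⁻ ω, M 0 ω ∂P ≤ 1)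
    (hstep : ∀ t < T, ∫⁻ ω in {ω | ∀ s ≤ t, M s ω ≤ c}, M (t + 1) ω ∂P
      ≤ ∫⁻ ω in {ω | ∀ s ≤ t, M s ω ≤ c}, M t ω ∂P) :
    c * P {ω | ∃ s ≤ T, c < M s ω} ≤ 1 := by
  have hS : ∀ t ≤ T, MeasurableSet {ω | ∀ s ≤ t, M s ω ≤ c} := by
    intro t ht
    have : {ω | ∀ s ≤ t, M s ω ≤ c} = ⋂ s ∈ Set.Iic t, {ω | M s ω ≤ c} := by ext; simp
    rw [this]
    exact MeasurableSet.biInter (Set.to_countable _) fun s hs =>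
      measurableSet_le (hmeas s (le_trans hs ht)) measurable_const
  have hcompl : ∀ t, {ω | ∃ s ≤ t, c < M s ω} = {ω | ∀ s ≤ t, M s ω ≤ c}ᶜ := by
    intro t; ext ω; simp
  -- The mass of the process stopped at its first passage above `c` does not increase.
  have key : ∀ t ≤ T, (∫⁻ ω in {ω | ∀ s ≤ t, M s ω ≤ c}, M t ω ∂P)
      + c * P {ω | ∃ s ≤ t, c < M s ω} ≤ 1 := by
    intro t
    induction t with
    | zero =>
      intro _
      refine le_trans ?_ h0
      rw [hcompl, ← lintegral_add_compl (μ := P) (M 0) (hS 0 (Nat.zero_le _)),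
        ← setLIntegral_const]
      refine add_le_add le_rfl ?_
      refine setLIntegral_mono' (hS 0 (Nat.zero_le _)).compl fun ω hω => ?_
      simpa using (show ¬ _ from hω) |> fun h => (by simpa using h : c < M 0 ω).le
    | succ t ih =>
      intro ht
      refine le_trans ?_ (ih (by omega))
      have hSt := hS t (by omega)
      have hSt1 := hS (t + 1) ht
      have hsub : {ω | ∀ s ≤ t + 1, M s ω ≤ c} ⊆ {ω | ∀ s ≤ t, M s ω ≤ c} :=
        fun ω h s hs => h s (by omega)
      have hdiff : MeasurableSet ({ω | ∀ s ≤ t, M s ω ≤ c} \ {ω | ∀ s ≤ t + 1, M s ω ≤ c}) :=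
        hSt.diff hSt1
      have hsplit : ∫⁻ ω in {ω | ∀ s ≤ t, M s ω ≤ c}, M (t + 1) ω ∂P
          = ∫⁻ ω in {ω | ∀ s ≤ t + 1, M s ω ≤ c}, M (t + 1) ω ∂P
            + ∫⁻ ω in {ω | ∀ s ≤ t, M s ω ≤ c} \ {ω | ∀ s ≤ t + 1, M s ω ≤ c},
                M (t + 1) ω ∂P := by
        rw [← lintegral_union hdiff Set.disjoint_sdiff_right, Set.union_sdiff_cancel hsub]
      have hbad : c * P {ω | ∃ s ≤ t + 1, c < M s ω}
          = c * P ({ω | ∀ s ≤ t, M s ω ≤ c} \ {ω | ∀ s ≤ t + 1, M s ω ≤ c})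
            + c * P {ω | ∃ s ≤ t, c < M s ω} := by
        rw [← mul_add, ← measure_union _ (by rw [hcompl]; exact hSt.compl)]
        · congr 2
          rw [hcompl, hcompl]
          ext ω
          have := @hsub ω
          simp only [Set.mem_compl_iff, Set.mem_union, Set.mem_sdiff]
          tauto
        · rw [hcompl]
          exact disjoint_compl_right.mono_left Set.sdiff_subset
      have hge : c * P ({ω | ∀ s ≤ t, M s ω ≤ c} \ {ω | ∀ s ≤ t + 1, M s ω ≤ c})
          ≤ ∫⁻ ω in {ω | ∀ s ≤ t, M s ω ≤ c} \ {ω | ∀ s ≤ t + 1, M s ω ≤ c},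
                M (t + 1) ω ∂P := by
        rw [← setLIntegral_const]
        refine setLIntegral_mono' hdiff fun ω hω => ?_
        by_contra hlt
        refine hω.2 fun s hs => ?_
        rcases Nat.lt_or_ge s (t + 1) with h | h
        · exact hω.1 s (by omega)
        · obtain rfl : s = t + 1 := by omega
          exact (not_le.1 hlt).le
      calc _ = (∫⁻ ω in {ω | ∀ s ≤ t + 1, M s ω ≤ c}, M (t + 1) ω ∂P
              + c * P ({ω | ∀ s ≤ t, M s ω ≤ c} \ {ω | ∀ s ≤ t + 1, M s ω ≤ c}))
            + c * P {ω | ∃ s ≤ t, c < M s ω} := by rw [hbad, add_assoc]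
        _ ≤ _ := by
          gcongr
          refine le_trans ?_ (hstep t (by omega))
          rw [hsplit]
          gcongr
  exact le_trans le_add_self (key T le_rfl)

/-- Noise with variance proxy `0` vanishes, since `E[exp η + exp (-η)] ≤ 2`, the pointwise minimum of the integrand. -/
theorem ae_eq_zero_of_subGaussian_zero [IsProbabilityMeasure P] (hm : m ≤ m0)
    {η : Ω → ℝ}
    (hint : ∀ σ : ℝ, Integrable (fun ω => Real.exp (σ * η ω)) P)
    (hle : ∀ σ : ℝ, P[fun ω => Real.exp (σ * η ω) | m] ≤ᵐ[P] fun _ => 1) :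
    ∀ᵐ ω ∂P, η ω = 0 := by
  have h : ∀ σ : ℝ, ∫ ω, Real.exp (σ * η ω) ∂P ≤ 1 := by
    intro σ
    rw [← integral_condExp hm]
    calc _ ≤ ∫ _ω, (1 : ℝ) ∂P := integral_mono_ae integrable_condExp (integrable_const _) (hle σ)
      _ = 1 := by simp
  have h1 := h 1
  have h2 := h (-1)
  have i1 := hint 1
  have i2 := hint (-1)
  have hnn : ∀ ω, 0 ≤ Real.exp (1 * η ω) + Real.exp (-1 * η ω) - 2 := by
    intro ω
    have := Real.add_one_le_exp (1 * η ω)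
    have := Real.add_one_le_exp (-1 * η ω)
    linarith
  have hz : ∫ ω, (Real.exp (1 * η ω) + Real.exp (-1 * η ω) - 2) ∂P = 0 := by
    refine le_antisymm ?_ (integral_nonneg hnn)
    have hadd : Integrable (fun ω => Real.exp (1 * η ω) + Real.exp (-1 * η ω)) P := i1.add i2
    rw [integral_sub hadd (integrable_const _), integral_add i1 i2]
    simp at h1 h2 ⊢
    linarith
  rw [integral_eq_zero_iff_of_nonneg hnn ((i1.add i2).sub (integrable_const _))] at hz
  filter_upwards [hz] with ω hω
  simp only [Pi.zero_apply] at hω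
  by_contra hne
  have := Real.add_one_lt_exp (x := 1 * η ω) (by simpa using hne)
  have := Real.add_one_le_exp (-1 * η ω)
  linarith

end Supermartingale

/-! ### Measurability -/

section Measurability
variable {Ω : Type*} {mΩ : MeasurableSpace Ω} {n : ℕ}

theorem measurable_det {F : Ω → Matrix (Fin n) (Fin n) ℝ}
    (hF : ∀ i j, Measurable fun ω => F ω i j) : Measurable fun ω => (F ω).det := by
  simp_rw [Matrix.det_apply']
  exact Finset.measurable_sum _ fun σ _ =>
    (Finset.measurable_prod _ fun i _ => hF _ _).const_mul _

theorem measurable_matrix_inv {F : Ω → Matrix (Fin n) (Fin n) ℝ}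
    (hF : ∀ i j, Measurable fun ω => F ω i j) (i j : Fin n) :
    Measurable fun ω => (F ω)⁻¹ i j := by
  simp_rw [Matrix.inv_def, Ring.inverse_eq_inv', Matrix.smul_apply, smul_eq_mul,
    Matrix.adjugate_apply]
  refine (measurable_det hF).inv.mul (measurable_det fun i' j' => ?_)
  by_cases h : i' = j
  · subst h; simp
  · simpa [Matrix.updateRow_ne h] using hF i' j'

variable {Z : Type*} [MeasurableSpace Z] {k : Z → Z → ℝ} {z : ℕ → Ω → Z} {lam : ℝ}

theorem measurable_kvec (hk : Measurable fun p : Z × Z => k p.1 p.2)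
    (hz : ∀ t ∈ Set.Icc 1 n, Measurable (z t)) {w : Ω → Z} (hw : Measurable w) (i : Fin n) :
    Measurable fun ω => kvec k (fun t => z t ω) n (w ω) i :=
  hk.comp (hw.prodMk (hz (i + 1) ⟨by omega, i.2⟩))

theorem measurable_gram (hk : Measurable fun p : Z × Z => k p.1 p.2)
    (hz : ∀ t ∈ Set.Icc 1 n, Measurable (z t)) (i j : Fin n) :
    Measurable fun ω => gram k (fun t => z t ω) n i j :=
  hk.comp ((hz (i + 1) ⟨by omega, i.2⟩).prodMk (hz (j + 1) ⟨by omega, j.2⟩))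

theorem measurable_ridgeInv (hk : Measurable fun p : Z × Z => k p.1 p.2)
    (hz : ∀ t ∈ Set.Icc 1 n, Measurable (z t)) (i j : Fin n) :
    Measurable fun ω => ridgeInv k (fun t => z t ω) lam n i j :=
  measurable_matrix_inv
    (fun i j => (measurable_gram hk hz i j).add measurable_const) i j

theorem measurable_dotProduct_ridgeInv (hk : Measurable fun p : Z × Z => k p.1 p.2)
    (hz : ∀ t ∈ Set.Icc 1 n, Measurable (z t)) {u v : Ω → Fin n → ℝ}
    (hu : ∀ i, Measurable fun ω => u ω i) (hv : ∀ i, Measurable fun ω => v ω i) :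
    Measurable fun ω => u ω ⬝ᵥ (ridgeInv k (fun t => z t ω) lam n *ᵥ v ω) := by
  simp only [dotProduct, Matrix.mulVec]
  exact Finset.measurable_sum _ fun i _ => (hu i).mul <|
    Finset.measurable_sum _ fun j _ => (measurable_ridgeInv hk hz i j).mul (hv j)

theorem measurable_infoGain (hk : Measurable fun p : Z × Z => k p.1 p.2)
    (hz : ∀ t ∈ Set.Icc 1 n, Measurable (z t)) :
    Measurable fun ω => infoGain k (fun t => z t ω) lam n :=
  (measurable_det fun i j => ((measurable_gram hk hz i j).const_mul _).const_add _).log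

theorem measurable_confWidth (hk : Measurable fun p : Z × Z => k p.1 p.2)
    (hz : ∀ t ∈ Set.Icc 1 n, Measurable (z t)) {w : Ω → Z} (hw : Measurable w) :
    Measurable fun ω => confWidth k (fun t => z t ω) lam n (w ω) :=
  (((hk.comp (hw.prodMk hw)).const_mul _).sub
    ((measurable_dotProduct_ridgeInv hk hz (measurable_kvec hk hz hw)
      (measurable_kvec hk hz hw)).const_mul _)).sqrt

theorem measurable_ridgeEstimate (hk : Measurable fun p : Z × Z => k p.1 p.2)
    (hz : ∀ t ∈ Set.Icc 1 n, Measurable (z t)) {w : Ω → Z} (hw : Measurable w)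
    {e : ℕ → Ω → ℝ} (he : ∀ t ∈ Set.Icc 1 n, Measurable (e t)) :
    Measurable fun ω => ridgeEstimate k (fun t => z t ω) (fun t => e t ω) lam n (w ω) :=
  measurable_dotProduct_ridgeInv hk hz (measurable_kvec hk hz hw)
    fun i => he (i + 1) ⟨by omega, i.2⟩

theorem measurable_selfNormSq (hk : Measurable fun p : Z × Z => k p.1 p.2)
    (hz : ∀ t ∈ Set.Icc 1 n, Measurable (z t)) {e : ℕ → Ω → ℝ}
    (he : ∀ t ∈ Set.Icc 1 n, Measurable (e t)) :
    Measurable fun ω => selfNormSq k (fun t => z t ω) lam n (fun t => e t ω) := by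
  have he' : ∀ i : Fin n, Measurable fun ω => e (i + 1) ω := fun i => he (i + 1) ⟨by omega, i.2⟩
  exact (Finset.measurable_sum _ fun i _ => (he' i).mul (he' i)).sub
    ((measurable_dotProduct_ridgeInv hk hz he' he').const_mul _)

end Measurability

section PreNoise
variable {Ω Z : Type*} [MeasurableSpace Z] {z : ℕ → Ω → Z} {y : ℕ → Ω → ℝ} {t τ : ℕ}

theorem measurable_preNoise_point (hτ : τ ∈ Set.Icc 1 t) : Measurable[preNoise z y t] (z τ) :=
  (comap_measurable (z τ)).mono
    (le_sup_of_le_left (le_iSup₂_of_le τ hτ le_rfl)) le_rfl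

theorem measurable_preNoise_reward (hτ : τ ∈ Set.Ico 1 t) : Measurable[preNoise z y t] (y τ) :=
  (comap_measurable (y τ)).mono
    (le_sup_of_le_right (le_iSup₂_of_le τ hτ le_rfl)) le_rfl

theorem preNoise_le [m0 : MeasurableSpace Ω] (hz : ∀ τ ∈ Set.Icc 1 t, Measurable (z τ))
    (hy : ∀ τ ∈ Set.Ico 1 t, Measurable (y τ)) : preNoise z y t ≤ m0 :=
  sup_le (iSup₂_le fun τ hτ => (hz τ hτ).comap_le) (iSup₂_le fun τ hτ => (hy τ hτ).comap_le)

end PreNoise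

/-! ### Self-normalized concentration -/

section Concentration
variable {Ω Z H : Type*} [NormedAddCommGroup H] [InnerProductSpace ℝ H]
  {k : Z → Z → ℝ} {φ : Z → H} {lam b δ : ℝ} {z : ℕ → Ω → Z} {η y : ℕ → Ω → ℝ} {F : Z → ℝ}

/-- The mixture supermartingale `det (I + K / λ)^(-1/2) exp (eᵀ K (K + λ I)⁻¹ e / (2 b²))` of the
self-normalized concentration inequality, with values in `ℝ≥0∞`. -/
noncomputable def expSelfNorm (k : Z → Z → ℝ) (z : ℕ → Ω → Z) (η : ℕ → Ω → ℝ) (lam b : ℝ) (t : ℕ)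
    (ω : Ω) : ℝ≥0∞ :=
  ENNReal.ofReal (Real.exp (selfNormSq k (fun τ => z τ ω) lam t (fun τ => η τ ω) / (2 * b ^ 2)
    - infoGain k (fun τ => z τ ω) lam t / 2))

theorem expSelfNorm_succ (hφ : IsFeatureMap k φ) (hlam : 0 < lam) (t : ℕ) (ω : Ω) :
    expSelfNorm k z η lam b (t + 1) ω = expSelfNorm k z η lam b t ω *
      ENNReal.ofReal (Real.exp
        ((confWidth k (fun τ => z τ ω) lam t (z (t + 1) ω) ^ 2 * η (t + 1) ω ^ 2
          + 2 * η (t + 1) ω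
            * ridgeEstimate k (fun τ => z τ ω) (fun τ => η τ ω) lam t (z (t + 1) ω)
          - ridgeEstimate k (fun τ => z τ ω) (fun τ => η τ ω) lam t (z (t + 1) ω) ^ 2)
          / (1 + confWidth k (fun τ => z τ ω) lam t (z (t + 1) ω) ^ 2) / (2 * b ^ 2))
        / Real.sqrt (1 + confWidth k (fun τ => z τ ω) lam t (z (t + 1) ω) ^ 2)) := by
  rw [expSelfNorm, expSelfNorm, ← ENNReal.ofReal_mul (Real.exp_pos _).le,
    selfNormSq_succ hφ hlam _ rfl rfl, infoGain_succ hφ hlam]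
  set r := confWidth k (fun τ => z τ ω) lam t (z (t + 1) ω) ^ 2 with hr
  have hr0 : 0 < 1 + r := by positivity
  have hsqrt : Real.sqrt (1 + r) = Real.exp (Real.log (1 + r) / 2) := by
    rw [Real.sqrt_eq_rpow, Real.rpow_def_of_pos hr0]
    congr 1; ring
  rw [hsqrt, ← Real.exp_sub, ← Real.exp_add]
  congr 2
  ring

variable [MeasurableSpace Ω] [MeasurableSpace Z] {P : Measure Ω}

theorem setLIntegral_expSelfNorm_succ_le [IsProbabilityMeasure P] (hφ : IsFeatureMap k φ)
    (hlam : 0 < lam) (hb : 0 < b) (hk : Measurable fun p : Z × Z => k p.1 p.2) (hF : Measurable F)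
    {t : ℕ} (hz : ∀ τ ∈ Set.Icc 1 (t + 1), Measurable (z τ))
    (hη : ∀ τ ∈ Set.Icc 1 (t + 1), Measurable (η τ))
    (hy : ∀ τ ∈ Set.Icc 1 (t + 1), ∀ ω, y τ ω = F (z τ ω) + η τ ω)
    (hint : ∀ σ : ℝ, Integrable (fun ω => Real.exp (σ * η (t + 1) ω)) P)
    (hsub : ∀ σ : ℝ, P[fun ω => Real.exp (σ * η (t + 1) ω) | preNoise z y (t + 1)]
      ≤ᵐ[P] fun _ => Real.exp (σ ^ 2 * b ^ 2 / 2)) (c : ℝ≥0∞) :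
    ∫⁻ ω in {ω | ∀ s ≤ t, expSelfNorm k z η lam b s ω ≤ c}, expSelfNorm k z η lam b (t + 1) ω ∂P
      ≤ ∫⁻ ω in {ω | ∀ s ≤ t, expSelfNorm k z η lam b s ω ≤ c}, expSelfNorm k z η lam b t ω ∂P := by
  have hym : ∀ τ ∈ Set.Icc 1 (t + 1), Measurable (y τ) := fun τ hτ => by
    rw [funext (hy τ hτ)]
    exact (hF.comp (hz τ hτ)).add (hη τ hτ)
  have hle := preNoise_le (t := t + 1) hz fun τ hτ => hym τ ⟨hτ.1, hτ.2.le⟩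
  have hzm : ∀ τ ∈ Set.Icc 1 (t + 1), Measurable[preNoise z y (t + 1)] (z τ) :=
    fun τ hτ => measurable_preNoise_point hτ
  -- The past noises are functions of the past points and rewards.
  have hηm : ∀ τ ∈ Set.Icc 1 t, Measurable[preNoise z y (t + 1)] (η τ) := fun τ hτ => by
    have h : η τ = fun ω => y τ ω - F (z τ ω) :=
      funext fun ω => by rw [hy τ ⟨hτ.1, hτ.2.trans (Nat.le_succ t)⟩]; ring
    rw [h]
    exact (measurable_preNoise_reward ⟨hτ.1, Nat.lt_succ_of_le hτ.2⟩).sub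
      (hF.comp (hzm τ ⟨hτ.1, hτ.2.trans (Nat.le_succ t)⟩))
  have hM : ∀ s ≤ t, Measurable[preNoise z y (t + 1)] (expSelfNorm k z η lam b s) := by
    intro s hs
    have hz' : ∀ τ ∈ Set.Icc 1 s, Measurable[preNoise z y (t + 1)] (z τ) :=
      fun τ hτ => hzm τ ⟨hτ.1, hτ.2.trans (by omega)⟩
    have hη' : ∀ τ ∈ Set.Icc 1 s, Measurable[preNoise z y (t + 1)] (η τ) :=
      fun τ hτ => hηm τ ⟨hτ.1, hτ.2.trans hs⟩
    exact (((measurable_selfNormSq hk hz' hη').div_const _).sub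
      ((measurable_infoGain hk hz').div_const _)).exp.ennreal_ofReal
  have hS : MeasurableSet[preNoise z y (t + 1)]
      {ω | ∀ s ≤ t, expSelfNorm k z η lam b s ω ≤ c} := by
    have : {ω | ∀ s ≤ t, expSelfNorm k z η lam b s ω ≤ c}
        = ⋂ s ∈ Set.Iic t, expSelfNorm k z η lam b s ⁻¹' Set.Iic c := by ext; simp
    rw [this]
    exact MeasurableSet.biInter (Set.to_countable _) fun s hs => hM s hs measurableSet_Iic
  have hz' : ∀ τ ∈ Set.Icc 1 t, Measurable[preNoise z y (t + 1)] (z τ) :=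
    fun τ hτ => hzm τ ⟨hτ.1, hτ.2.trans (Nat.le_succ t)⟩
  have hlast := hzm (t + 1) ⟨by omega, le_rfl⟩
  have h := lintegral_mul_exp_mixture_le hle (hη (t + 1) ⟨by omega, le_rfl⟩) hb hint hsub
    ((hM t le_rfl).indicator hS) ((measurable_confWidth (lam := lam) hk hz' hlast).pow_const 2)
    (measurable_ridgeEstimate (lam := lam) hk hz' hlast hηm) (fun ω => sq_nonneg _)
  rw [← lintegral_indicator (hle _ hS), ← lintegral_indicator (hle _ hS)]
  refine le_trans (lintegral_mono fun ω => ?_) h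
  by_cases hω : ω ∈ {ω | ∀ s ≤ t, expSelfNorm k z η lam b s ω ≤ c}
  · rw [Set.indicator_of_mem hω, Set.indicator_of_mem hω, expSelfNorm_succ hφ hlam]
  · simp [Set.indicator_of_notMem hω]

/-- Self-normalized concentration, uniformly over the rounds: for `b > 0`, Ville's inequality for
`expSelfNorm` at level `1 / δ`; for `b = 0`, the noise vanishes almost surely. -/
theorem exists_event_selfNormSq_le [IsProbabilityMeasure P] (hφ : IsFeatureMap k φ)
    (hlam : 0 < lam) (hb : 0 ≤ b) (hδ : 0 < δ)
    (hk : Measurable fun p : Z × Z => k p.1 p.2) (hF : Measurable F) (N : ℕ∞)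
    (hz : ∀ t : ℕ, 1 ≤ t → (t : ℕ∞) ≤ N → Measurable (z t))
    (hη : ∀ t : ℕ, 1 ≤ t → (t : ℕ∞) ≤ N → Measurable (η t))
    (hy : ∀ t : ℕ, 1 ≤ t → (t : ℕ∞) ≤ N → ∀ ω, y t ω = F (z t ω) + η t ω)
    (hint : ∀ t : ℕ, 1 ≤ t → (t : ℕ∞) ≤ N → ∀ σ : ℝ,
      Integrable (fun ω => Real.exp (σ * η t ω)) P)
    (hsub : ∀ t : ℕ, 1 ≤ t → (t : ℕ∞) ≤ N → ∀ σ : ℝ,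
      P[fun ω => Real.exp (σ * η t ω) | preNoise z y t]
        ≤ᵐ[P] fun _ => Real.exp (σ ^ 2 * b ^ 2 / 2)) :
    ∃ good : Set Ω, MeasurableSet good ∧ ENNReal.ofReal (1 - δ) ≤ P good ∧
      ∀ ω ∈ good, ∀ t : ℕ, (t : ℕ∞) ≤ N →
        selfNormSq k (fun τ => z τ ω) lam t (fun τ => η τ ω)
          ≤ b ^ 2 * (infoGain k (fun τ => z τ ω) lam t - 2 * Real.log δ) := by
  have hN : ∀ {s t : ℕ}, s ≤ t → (t : ℕ∞) ≤ N → (s : ℕ∞) ≤ N :=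
    fun hst ht => le_trans (by exact_mod_cast hst) ht
  have hzN : ∀ t : ℕ, (t : ℕ∞) ≤ N → ∀ τ ∈ Set.Icc 1 t, Measurable (z τ) :=
    fun t ht τ hτ => hz τ hτ.1 (hN hτ.2 ht)
  have hηN : ∀ t : ℕ, (t : ℕ∞) ≤ N → ∀ τ ∈ Set.Icc 1 t, Measurable (η τ) :=
    fun t ht τ hτ => hη τ hτ.1 (hN hτ.2 ht)
  rcases hb.eq_or_lt with rfl | hb
  · have hmeas : MeasurableSet (⋂ t : ℕ, ⋂ (_ : 1 ≤ t ∧ (t : ℕ∞) ≤ N), {ω | η t ω = 0}) :=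
      MeasurableSet.iInter fun t => MeasurableSet.iInter fun ht =>
        hη t ht.1 ht.2 (measurableSet_singleton 0)
    refine ⟨_, hmeas, ?_, ?_⟩
    · have hae : ∀ᵐ ω ∂P, ω ∈ ⋂ t : ℕ, ⋂ (_ : 1 ≤ t ∧ (t : ℕ∞) ≤ N), {ω | η t ω = 0} := by
        simp only [Set.mem_iInter, Set.mem_ofPred_eq, ae_all_iff]
        intro t ht
        have hle : preNoise z y t ≤ _ := preNoise_le (hzN t ht.2) fun τ hτ => by
          have hτ' := hN hτ.2.le ht.2
          rw [funext (hy τ hτ.1 hτ')]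
          exact (hF.comp (hz τ hτ.1 hτ')).add (hη τ hτ.1 hτ')
        exact ae_eq_zero_of_subGaussian_zero hle (hint t ht.1 ht.2)
          (by simpa using hsub t ht.1 ht.2)
      rw [(mem_ae_iff_prob_eq_one hmeas).1 hae, ENNReal.ofReal_le_one]
      linarith
    · intro ω hω t ht
      have h0 : (fun i : Fin t => η (i + 1) ω) = 0 := funext fun i => by
        simp only [Set.mem_iInter] at hω
        exact hω (i + 1) ⟨by omega, hN i.2 ht⟩
      simp [selfNormSq, h0]
  set c : ℝ≥0∞ := ENNReal.ofReal (1 / δ) with hc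
  have hMm : ∀ t : ℕ, (t : ℕ∞) ≤ N → Measurable (expSelfNorm k z η lam b t) := fun t ht =>
    (((measurable_selfNormSq hk (hzN t ht) (hηN t ht)).div_const _).sub
      ((measurable_infoGain hk (hzN t ht)).div_const _)).exp.ennreal_ofReal
  have hville : ∀ T : ℕ, (T : ℕ∞) ≤ N →
      P {ω | ∃ s ≤ T, c < expSelfNorm k z η lam b s ω} ≤ ENNReal.ofReal δ := by
    intro T hT
    have h := measure_exists_lt_le_of_supermartingale (P := P) (M := expSelfNorm k z η lam b)
      (T := T) (c := c) (fun t ht => hMm t (hN ht hT))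
      (by simp [expSelfNorm, selfNormSq_zero, infoGain_zero])
      (fun t ht => setLIntegral_expSelfNorm_succ_le hφ hlam hb hk hF
        (hzN _ (hN ht hT)) (hηN _ (hN ht hT)) (fun τ hτ => hy τ hτ.1 (hN (hτ.2.trans ht) hT))
        (hint _ (by omega) (hN ht hT)) (hsub _ (by omega) (hN ht hT)) c)
    have hcδ : ENNReal.ofReal δ * c = 1 := by
      rw [hc, ← ENNReal.ofReal_mul hδ.le, mul_one_div_cancel hδ.ne', ENNReal.ofReal_one]
    calc _ = ENNReal.ofReal δ * (c * P {ω | ∃ s ≤ T, c < expSelfNorm k z η lam b s ω}) := by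
          rw [← mul_assoc, hcδ, one_mul]
      _ ≤ ENNReal.ofReal δ * 1 := by gcongr
      _ = _ := mul_one _
  set bad : ℕ → Set Ω := fun T => {ω | ∃ s ≤ T, (s : ℕ∞) ≤ N ∧ c < expSelfNorm k z η lam b s ω}
  have hbad : ∀ T, P (bad T) ≤ ENNReal.ofReal δ := by
    intro T
    by_cases hT : (T : ℕ∞) ≤ N
    · exact (measure_mono fun ω hω => hω.imp fun s h => ⟨h.1, h.2.2⟩).trans (hville T hT)
    · obtain ⟨N', rfl⟩ := ENat.ne_top_iff_exists.1 (ne_top_of_lt (not_le.1 hT))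
      exact (measure_mono fun ω hω => hω.imp fun s h =>
        ⟨by exact_mod_cast h.2.1, h.2.2⟩).trans
        (hville N' le_rfl)
  have hbadm : ∀ T, MeasurableSet (bad T) := by
    intro T
    have : bad T = ⋃ s : ℕ, ⋃ (_ : s ≤ T ∧ (s : ℕ∞) ≤ N),
        {ω | c < expSelfNorm k z η lam b s ω} := by ext; simp [bad, and_assoc]
    rw [this]
    exact MeasurableSet.iUnion fun s => MeasurableSet.iUnion fun hs =>
      measurableSet_lt measurable_const (hMm s hs.2)
  have hmono : Monotone bad := fun T T' h ω ⟨s, hs, h'⟩ => ⟨s, hs.trans h, h'⟩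
  refine ⟨(⋃ T, bad T)ᶜ, (MeasurableSet.iUnion hbadm).compl, ?_, ?_⟩
  · rw [prob_compl_eq_one_sub (MeasurableSet.iUnion hbadm), hmono.measure_iUnion,
      ENNReal.ofReal_sub _ hδ.le, ENNReal.ofReal_one]
    exact tsub_le_tsub_left (iSup_le hbad) _
  · intro ω hω t ht
    have h : expSelfNorm k z η lam b t ω ≤ c := by
      by_contra hlt
      exact hω (Set.mem_iUnion.2 ⟨t, t, le_rfl, ht, not_le.1 hlt⟩)
    rw [expSelfNorm, hc, ENNReal.ofReal_le_ofReal_iff (by positivity),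
      ← Real.le_log_iff_exp_le (by positivity), Real.log_div one_ne_zero hδ.ne', Real.log_one] at h
    have h2 : selfNormSq k (fun τ => z τ ω) lam t (fun τ => η τ ω) / (2 * b ^ 2)
        ≤ (infoGain k (fun τ => z τ ω) lam t - 2 * Real.log δ) / 2 := by linarith
    rw [div_le_iff₀ (by positivity)] at h2
    linarith

end Concentration

/-! ### Confidence bands and optimism -/

section Confidence
variable {Z H : Type*} [NormedAddCommGroup H] [InnerProductSpace ℝ H]
variable {k : Z → Z → ℝ} {φ : Z → H} {z : ℕ → Z} {lam B b δ : ℝ} {n : ℕ}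

theorem ridgeEstimate_eq_add {y g e : ℕ → ℝ} (hy : ∀ i < n, y (i + 1) = g (i + 1) + e (i + 1))
    (w : Z) :
    ridgeEstimate k z y lam n w = ridgeEstimate k z g lam n w + ridgeEstimate k z e lam n w := by
  have : (fun i : Fin n => y (i + 1)) = (fun i : Fin n => g (i + 1)) + fun i : Fin n => e (i + 1) :=
    funext fun i => hy i i.2
  rw [ridgeEstimate, this, Matrix.mulVec_add, dotProduct_add]
  rfl

/-- The confidence band: the bias is at most `√λ B` and the noise at most `b √(γ - 2 log δ)` times
the confidence width. -/
theorem abs_inner_sub_ridgeEstimate_le_confCoeff (hφ : IsFeatureMap k φ) (hlam : 0 < lam)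
    (hb : 0 ≤ b) {f : H} (hf : ‖f‖ ≤ B) {y e : ℕ → ℝ}
    (hy : ∀ i < n, y (i + 1) = ⟪f, φ (z (i + 1))⟫ + e (i + 1))
    (he : selfNormSq k z lam n e ≤ b ^ 2 * (infoGain k z lam n - 2 * Real.log δ)) (w : Z) :
    |⟪f, φ w⟫ - ridgeEstimate k z y lam n w|
      ≤ confCoeff k z lam B b δ n * confWidth k z lam n w := by
  have hs : 0 ≤ confWidth k z lam n w := confWidth_nonneg w
  have h1 := abs_inner_sub_ridgeEstimate_le (z := z) (n := n) hφ hlam f w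
  have h2 : |ridgeEstimate k z e lam n w|
      ≤ confWidth k z lam n w * (b * Real.sqrt (infoGain k z lam n - 2 * Real.log δ)) := by
    have h := Real.sqrt_le_sqrt ((sq_ridgeEstimate_le (z := z) hφ hlam e w).trans
      (mul_le_mul_of_nonneg_left he (sq_nonneg (confWidth k z lam n w))))
    rwa [Real.sqrt_sq_eq_abs, Real.sqrt_mul (sq_nonneg _), Real.sqrt_mul (sq_nonneg _),
      Real.sqrt_sq hs, Real.sqrt_sq hb] at h
  rw [ridgeEstimate_eq_add (g := fun t => ⟪f, φ (z t)⟫) hy, ← sub_sub]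
  calc _ ≤ |⟪f, φ w⟫ - ridgeEstimate k z (fun t => ⟪f, φ (z t)⟫) lam n w|
        + |ridgeEstimate k z e lam n w| := abs_sub _ _
    _ ≤ Real.sqrt lam * B * confWidth k z lam n w
        + confWidth k z lam n w * (b * Real.sqrt (infoGain k z lam n - 2 * Real.log δ)) := by
      refine add_le_add (h1.trans ?_) h2
      gcongr
    _ = _ := by rw [confCoeff]; ring

theorem confCoeff_nonneg (hB : 0 ≤ B) (hb : 0 ≤ b) : 0 ≤ confCoeff k z lam B b δ n := by
  rw [confCoeff]; positivity

theorem monotone_confCoeff (hφ : IsFeatureMap k φ) (hlam : 0 < lam) (hb : 0 ≤ b) :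
    Monotone (confCoeff k z lam B b δ) := by
  intro s t hst
  have := monotone_infoGain (z := z) hφ hlam hst
  rw [confCoeff, confCoeff]
  gcongr

theorem sum_Icc_one_eq_sum_range (g : ℕ → ℝ) (T : ℕ) :
    ∑ t ∈ Finset.Icc 1 T, g t = ∑ t ∈ Finset.range T, g (t + 1) := by
  rw [Finset.range_eq_Ico, Finset.sum_Ico_add' g 0 T 1]
  rfl

/-- The sum of the widths of the confidence bands at the visited points, by Cauchy–Schwarz and the
elliptical potential lemma. -/
theorem sum_confCoeff_mul_confWidth_le (hφ : IsFeatureMap k φ) (hlam : 1 ≤ lam)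
    (hk : ∀ w, k w w ≤ 1) (hB : 0 ≤ B) (hb : 0 ≤ b) {T d : ℕ} (hd : d = (gram k z T).rank) :
    ∑ t ∈ Finset.Icc 1 T, 2 * confCoeff k z lam B b δ (t - 1) * confWidth k z lam (t - 1) (z t)
      ≤ 2 * confCoeff k z lam B b δ (T - 1)
        * Real.sqrt (2 * T * d * Real.log (1 + T / (d * lam))) := by
  have hl : 0 < lam := by linarith
  have hc : 0 ≤ confCoeff k z lam B b δ (T - 1) := confCoeff_nonneg hB hb
  calc _ ≤ ∑ t ∈ Finset.Icc 1 T,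
        2 * confCoeff k z lam B b δ (T - 1) * confWidth k z lam (t - 1) (z t) := by
        refine Finset.sum_le_sum fun t ht => ?_
        have := monotone_confCoeff (z := z) (B := B) (δ := δ) hφ hl hb
          (Nat.sub_le_sub_right (Finset.mem_Icc.1 ht).2 1)
        have := confWidth_nonneg (k := k) (z := z) (lam := lam) (n := t - 1) (z t)
        gcongr
    _ = 2 * confCoeff k z lam B b δ (T - 1)
          * ∑ t ∈ Finset.range T, confWidth k z lam t (z (t + 1)) := by
        rw [← Finset.mul_sum, sum_Icc_one_eq_sum_range]
        simp
    _ ≤ _ := by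
        gcongr
        refine Real.le_sqrt_of_sq_le ?_
        have h1 := sq_sum_le_card_mul_sum_sq (s := Finset.range T)
          (f := fun t => confWidth k z lam t (z (t + 1)))
        rw [Finset.card_range] at h1
        calc _ ≤ (T : ℝ) * (2 * infoGain k z lam T) := by
              refine h1.trans ?_
              gcongr
              exact sum_sq_confWidth_le hφ hlam hk T
          _ ≤ (T : ℝ) * (2 * (d * Real.log (1 + T / (d * lam)))) := by
              gcongr
              exact infoGain_le hφ hl hk hd
          _ = _ := by ring

end Confidence

/-- Optimism: if `U` dominates `g`, the max-min value of `g` is at most `U` at any context of `S`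
with the arm chosen by `U`. The lower bound `m` excludes infima of sets unbounded below, which have
the value `0` in Lean. -/
theorem maxMinValue_le {X A : Type*} {g U : X × A → ℝ} {S : Set X} {a : A} {x : X} {m : ℝ}
    (hx : x ∈ S) (ha : IsMaxMinArm U S a) (hm : ∀ w, m ≤ g w) (hU : ∀ w, g w ≤ U w) :
    maxMinValue g S ≤ U (x, a) := by
  have : Nonempty A := ⟨a⟩
  have hbg : ∀ a', BddBelow (Set.range fun x : S => g (x, a')) :=
    fun a' => ⟨m, by rintro _ ⟨x, rfl⟩; exact hm _⟩
  have hbU : BddBelow (Set.range fun x : S => U (x, a)) :=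
    ⟨m, by rintro _ ⟨x, rfl⟩; exact (hm _).trans (hU _)⟩
  refine ciSup_le fun a' => ?_
  calc worstValue g S a' ≤ worstValue U S a' := ciInf_mono (hbg a') fun x => hU _
    _ ≤ worstValue U S a := ha a'
    _ ≤ U (x, a) := ciInf_le hbU ⟨x, hx⟩

/-! ### Sublinearity for bounded rank -/

section Asymptotic

theorem isLittleO_sqrt_mul_sq_log (K : ℝ) :
    (fun T : ℕ => K * (Real.sqrt T * (1 + Real.log (1 + T)) ^ 2)) =o[atTop]
      fun T : ℕ => (T : ℝ) := by
  refine IsLittleO.const_mul_left ?_ K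
  have hO : (fun x : ℝ => 1 + Real.log (1 + x)) =O[atTop] fun x => Real.log (Real.sqrt x) := by
    refine IsBigO.of_bound 6 ?_
    filter_upwards [eventually_ge_atTop (Real.exp 1)] with x hx
    have hx1 : 1 ≤ x := le_trans (by simp) hx
    have hlx : 1 ≤ Real.log x := (Real.le_log_iff_exp_le (by linarith)).2 hx
    have h1 : Real.log (1 + x) ≤ 1 + Real.log x := by
      calc _ ≤ Real.log (2 * x) := Real.log_le_log (by linarith) (by linarith)
        _ = Real.log 2 + Real.log x := Real.log_mul (by norm_num) (by linarith)
        _ ≤ _ := by linarith [Real.log_two_lt_d9]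
    have h0 : 0 ≤ Real.log (1 + x) := Real.log_nonneg (by linarith)
    rw [Real.log_sqrt (by linarith), Real.norm_of_nonneg (by linarith),
      Real.norm_of_nonneg (by linarith)]
    linarith
  have ho : (fun x : ℝ => Real.log (Real.sqrt x) ^ 2) =o[atTop] fun x => Real.sqrt x :=
    (Real.isLittleO_pow_log_id_atTop (n := 2)).comp_tendsto Real.tendsto_sqrt_atTop
  have h : (fun x : ℝ => Real.sqrt x * (1 + Real.log (1 + x)) ^ 2) =o[atTop]
      fun x => Real.sqrt x * Real.sqrt x :=
    (isBigO_refl _ _).mul_isLittleO ((hO.pow 2).trans_isLittleO ho)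
  refine ((h.comp_tendsto tendsto_natCast_atTop_atTop).congr' ?_ ?_)
  · exact Eventually.of_forall fun T => rfl
  · exact Eventually.of_forall fun T => Real.mul_self_sqrt (Nat.cast_nonneg T)

variable {Z H : Type*} [NormedAddCommGroup H] [InnerProductSpace ℝ H]
variable {k : Z → Z → ℝ} {φ : Z → H} {z : ℕ → Z} {lam B b δ : ℝ}

theorem rank_mul_log_le {lam : ℝ} (hlam : 1 ≤ lam) {d D : ℕ} (hd : d ≤ D) (T : ℕ) :
    d * Real.log (1 + T / (d * lam)) ≤ D * (1 + Real.log (1 + T)) := by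
  have hT : 0 ≤ Real.log (1 + T) := Real.log_nonneg (by simp)
  rcases Nat.eq_zero_or_pos d with rfl | hpos
  · simp; positivity
  have h1 : (1 : ℝ) ≤ d := by exact_mod_cast hpos
  have h2 : (1 : ℝ) ≤ d * lam := by nlinarith
  have h3 : (T : ℝ) / (d * lam) ≤ T := div_le_self (Nat.cast_nonneg T) h2
  have h4 : Real.log (1 + T / (d * lam)) ≤ 1 + Real.log (1 + T) := by
    have := Real.log_le_log (x := 1 + (T : ℝ) / (d * lam)) (by positivity)
      (add_le_add_right h3 1)
    linarith
  have h5 : (d : ℝ) ≤ D := by exact_mod_cast hd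
  have h6 : 0 ≤ Real.log (1 + (T : ℝ) / (d * lam)) :=
    Real.log_nonneg (le_add_of_nonneg_right (by positivity))
  gcongr

/-- For kernel matrices of rank at most `D` the regret bound is at most a constant times
`√T (1 + log (1 + T))²`. -/
theorem regret_bound_le (hφ : IsFeatureMap k φ) (hlam : 1 ≤ lam) (hk : ∀ w, k w w ≤ 1)
    (hB : 0 ≤ B) (hb : 0 ≤ b) (hδ : δ ∈ Set.Ioo (0 : ℝ) 1) {T d D : ℕ}
    (hd : d = (gram k z T).rank) (hD : d ≤ D) :
    2 * confCoeff k z lam B b δ (T - 1) * Real.sqrt (2 * T * d * Real.log (1 + T / (d * lam)))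
      ≤ 2 * (Real.sqrt lam * B + b * Real.sqrt (D - 2 * Real.log δ)) * Real.sqrt (2 * D)
        * (Real.sqrt T * (1 + Real.log (1 + T)) ^ 2) := by
  have hl : 0 < lam := by linarith
  set l := 1 + Real.log (1 + (T : ℝ)) with hldef
  have hl1 : 1 ≤ l := by
    have : 0 ≤ Real.log (1 + (T : ℝ)) := Real.log_nonneg (by simp)
    linarith
  have hδ' : Real.log δ < 0 := Real.log_neg hδ.1 hδ.2
  have hdl : d * Real.log (1 + T / (d * lam)) ≤ D * l := rank_mul_log_le hlam hD T
  have hγ : infoGain k z lam (T - 1) ≤ D * l :=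
    ((monotone_infoGain (z := z) hφ hl (Nat.sub_le T 1)).trans (infoGain_le hφ hl hk hd)).trans hdl
  have hll : l ≤ l ^ 2 := by nlinarith
  have hcoef : confCoeff k z lam B b δ (T - 1)
      ≤ (Real.sqrt lam * B + b * Real.sqrt (D - 2 * Real.log δ)) * l := by
    have h1 : Real.sqrt (infoGain k z lam (T - 1) - 2 * Real.log δ)
        ≤ Real.sqrt (D - 2 * Real.log δ) * l := by
      rw [← Real.sqrt_sq (by linarith : 0 ≤ l), ← Real.sqrt_mul' _ (sq_nonneg l)]
      refine Real.sqrt_le_sqrt ?_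
      have h2 : (D : ℝ) * l ≤ D * l ^ 2 := by gcongr
      nlinarith
    have h3 : 0 ≤ Real.sqrt lam * B := by positivity
    rw [confCoeff, add_mul, mul_assoc b]
    refine add_le_add (le_mul_of_one_le_right h3 hl1) ?_
    gcongr
  have hroot : Real.sqrt (2 * T * d * Real.log (1 + T / (d * lam)))
      ≤ Real.sqrt (2 * D) * (Real.sqrt T * l) := by
    rw [← Real.sqrt_sq (by linarith : 0 ≤ l), ← Real.sqrt_mul' _ (sq_nonneg l),
      ← Real.sqrt_mul (by positivity)]
    refine Real.sqrt_le_sqrt ?_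
    calc 2 * (T : ℝ) * d * Real.log (1 + T / (d * lam))
        = 2 * T * (d * Real.log (1 + T / (d * lam))) := by ring
      _ ≤ 2 * T * (D * l) := by gcongr
      _ ≤ 2 * T * (D * l ^ 2) := by gcongr
      _ = _ := by ring
  have h0 : 0 ≤ confCoeff k z lam B b δ (T - 1) := confCoeff_nonneg hB hb
  calc _ ≤ 2 * ((Real.sqrt lam * B + b * Real.sqrt (D - 2 * Real.log δ)) * l)
        * (Real.sqrt (2 * D) * (Real.sqrt T * l)) := by gcongr
    _ = _ := by ring

end Asymptotic

/-! ### Functions in a reproducing kernel Hilbert space -/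

section RKHS
variable {Z H : Type*} [NormedAddCommGroup H] [InnerProductSpace ℝ H] [CompleteSpace H]
  [RKHS ℝ H Z ℝ]

theorem isFeatureMap_kerFun :
    IsFeatureMap (scalarKernel H) fun w : Z => RKHS.kerFun H w (1 : ℝ) := by
  intro w w'
  rw [RKHS.kerFun_inner, RKHS.kerFun_apply]
  simp [scalarKernel]

theorem apply_eq_inner_kerFun (f : H) (w : Z) : f w = ⟪f, RKHS.kerFun H w (1 : ℝ)⟫ := by
  rw [RKHS.inner_kerFun]
  simp

/-- Measurability passes from the kernel sections to their span and to pointwise limits, hence to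
all of `H`; no separability is needed. -/
theorem measurable_coe_of_measurable_kernel [MeasurableSpace Z]
    (hk : Measurable fun p : Z × Z => scalarKernel H p.1 p.2) (f : H) : Measurable f := by
  let V : Submodule ℝ H :=
    { carrier := {g | Measurable g}
      add_mem' := fun {g h} hg hh => by
        simpa only [Set.mem_ofPred_eq, RKHS.coe_add] using Measurable.add hg hh
      zero_mem' := by
        simpa only [Set.mem_ofPred_eq, RKHS.coe_zero] using measurable_zero
      smul_mem' := fun c g hg => by
        simpa only [Set.mem_ofPred_eq, RKHS.coe_smul] using Measurable.const_smul hg c }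
  have hspan : Submodule.span ℝ {RKHS.kerFun H x v | (x : Z) (v : ℝ)} ≤ V := by
    refine Submodule.span_le.2 ?_
    rintro _ ⟨x, v, rfl⟩
    have h : ⇑(RKHS.kerFun H x v) = fun w => v * scalarKernel H w x := by
      funext w
      rw [RKHS.kerFun_apply, scalarKernel, ← smul_eq_mul, ← map_smul, smul_eq_mul, mul_one]
    change Measurable ⇑(RKHS.kerFun H x v)
    rw [h]
    exact (hk.comp measurable_prodMk_right).const_mul v
  have hf : f ∈ closure (Submodule.span ℝ {RKHS.kerFun H x v | (x : Z) (v : ℝ)} : Set H) := by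
    rw [← Submodule.topologicalClosure_coe, RKHS.kerFun_dense]
    trivial
  obtain ⟨g, hg, hlim⟩ := mem_closure_iff_seq_limit.1 hf
  refine measurable_of_tendsto_metrizable (fun i => hspan (hg i)) (tendsto_pi_nhds.2 fun w => ?_)
  exact ((RKHS.continuous_eval w).tendsto f).comp hlim

theorem neg_norm_le_apply (hk : ∀ w : Z, scalarKernel H w w ≤ 1) (f : H) (w : Z) : -‖f‖ ≤ f w := by
  have h1 : ‖RKHS.kerFun H w (1 : ℝ)‖ ≤ 1 := by
    have := hk w
    rw [isFeatureMap_kerFun w w, real_inner_self_eq_norm_sq] at this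
    nlinarith [norm_nonneg (RKHS.kerFun H w (1 : ℝ))]
  have h2 := abs_real_inner_le_norm f (RKHS.kerFun H w (1 : ℝ))
  rw [← apply_eq_inner_kerFun] at h2
  have h3 : |f w| ≤ ‖f‖ := h2.trans (mul_le_of_le_one_right (norm_nonneg _) h1)
  exact (abs_le.1 h3).1

end RKHS

end KernelBandit

/-! ### Regret of MaxMinUCB -/

open KernelBandit RealInnerProductSpace in
theorem mainTheorem1
    {E G : Type*}
    [NormedAddCommGroup E] [NormedSpace ℝ E] [FiniteDimensional ℝ E]
    [MeasurableSpace E] [BorelSpace E]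
    [NormedAddCommGroup G] [NormedSpace ℝ G] [FiniteDimensional ℝ G]
    [MeasurableSpace G] [BorelSpace G]
    (X : Set E) (A : Set G)
    {H : Type*} [NormedAddCommGroup H] [InnerProductSpace ℝ H] [CompleteSpace H]
    [RKHS ℝ H (X × A) ℝ]
    (hk_meas : Measurable fun p : (X × A) × (X × A) => KernelBandit.scalarKernel H p.1 p.2)
    (hk_le : ∀ z : X × A, KernelBandit.scalarKernel H z z ≤ 1)
    (f : H) (B : ℝ) (hf : ‖f‖ ≤ B)
    (lam : ℝ) (hlam : 1 ≤ lam) (b : ℝ) (hb : 0 ≤ b)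
    (δ : ℝ) (hδ : δ ∈ Set.Ioo (0 : ℝ) 1) (Δ : ℝ)
    {Ω : Type*} [MeasurableSpace Ω] (P : Measure Ω) [IsProbabilityMeasure P]
    -- number of rounds, finite or infinite
    (N : ℕ∞)
    -- observed context, true context, selected arm, noise and reward of the rounds t = 1, 2, …, t ≤ N
    (xhat x : ℕ → Ω → X) (a : ℕ → Ω → A) (n y : ℕ → Ω → ℝ)
    (hx_meas : ∀ t : ℕ, 1 ≤ t → (t : ℕ∞) ≤ N → Measurable (x t))
    (ha_meas : ∀ t : ℕ, 1 ≤ t → (t : ℕ∞) ≤ N → Measurable (a t))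
    (hn_meas : ∀ t : ℕ, 1 ≤ t → (t : ℕ∞) ≤ N → Measurable (n t))
    (hx : ∀ t : ℕ, 1 ≤ t → (t : ℕ∞) ≤ N → ∀ ω, x t ω ∈ KernelBandit.defenseRegion Δ (xhat t ω))
    (hy : ∀ t : ℕ, 1 ≤ t → (t : ℕ∞) ≤ N → ∀ ω, y t ω = f (x t ω, a t ω) + n t ω)
    -- conditionally b-sub-Gaussian noise
    (hn_int : ∀ t : ℕ, 1 ≤ t → (t : ℕ∞) ≤ N → ∀ σ : ℝ, Integrable (fun ω => Real.exp (σ * n t ω)) P)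
    (hn_subG : ∀ t : ℕ, 1 ≤ t → (t : ℕ∞) ≤ N → ∀ σ : ℝ,
      P[fun ω => Real.exp (σ * n t ω) |
          KernelBandit.preNoise (fun τ ω => (x τ ω, a τ ω)) y t]
        ≤ᵐ[P] fun _ => Real.exp (σ ^ 2 * b ^ 2 / 2))
    -- MaxMinUCB
    (ha : ∀ t : ℕ, 1 ≤ t → (t : ℕ∞) ≤ N → ∀ ω, KernelBandit.IsMaxMinArm
      (KernelBandit.ucb (KernelBandit.scalarKernel H) (fun τ => (x τ ω, a τ ω))
        (fun τ => y τ ω) lam B b δ t)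
      (KernelBandit.defenseRegion Δ (xhat t ω)) (a t ω)) :
    ∃ good : Set Ω, MeasurableSet good ∧ ENNReal.ofReal (1 - δ) ≤ P good ∧
      ∀ ω ∈ good,
        (∀ T : ℕ, 1 ≤ T → (T : ℕ∞) ≤ N → ∀ d : ℕ,
          d = (KernelBandit.gram (KernelBandit.scalarKernel H)
                (fun τ => (x τ ω, a τ ω)) T).rank →
          ∑ t ∈ Finset.Icc 1 T, f (x t ω, a t ω) ≥
            ∑ t ∈ Finset.Icc 1 T, KernelBandit.maxMinValue f
                (KernelBandit.defenseRegion Δ (xhat t ω))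
              - 2 * KernelBandit.confCoeff (KernelBandit.scalarKernel H)
                    (fun τ => (x τ ω, a τ ω)) lam B b δ (T - 1)
                * Real.sqrt (2 * T * d * Real.log (1 + T / (d * lam)))) ∧
        (N = ⊤ → (∃ D : ℕ, ∀ T : ℕ, (KernelBandit.gram (KernelBandit.scalarKernel H)
                (fun τ => (x τ ω, a τ ω)) T).rank ≤ D) →
          KernelBandit.TypeIRobust
            (fun t => KernelBandit.maxMinValue f (KernelBandit.defenseRegion Δ (xhat t ω)))
            (fun t => f (x t ω, a t ω))) := by
  have hl : 0 < lam := by linarith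
  have hB : 0 ≤ B := (norm_nonneg f).trans hf
  have hφ : IsFeatureMap (scalarKernel H) fun w : X × A => RKHS.kerFun H w (1 : ℝ) :=
    isFeatureMap_kerFun
  obtain ⟨good, hgood, hP, hconf⟩ := exists_event_selfNormSq_le (P := P) hφ hl hb hδ.1 hk_meas
    (measurable_coe_of_measurable_kernel hk_meas f) N
    (fun t h1 hN => (hx_meas t h1 hN).prodMk (ha_meas t h1 hN)) hn_meas hy hn_int hn_subG
  -- On the good event, the regret of each round is at most the width of its confidence band.
  have hregret : ∀ ω ∈ good, ∀ T : ℕ, (T : ℕ∞) ≤ N → ∀ d : ℕ,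
      d = (gram (scalarKernel H) (fun τ => (x τ ω, a τ ω)) T).rank →
      ∑ t ∈ Finset.Icc 1 T, maxMinValue f (defenseRegion Δ (xhat t ω))
          - ∑ t ∈ Finset.Icc 1 T, f (x t ω, a t ω)
        ≤ 2 * confCoeff (scalarKernel H) (fun τ => (x τ ω, a τ ω)) lam B b δ (T - 1)
          * Real.sqrt (2 * T * d * Real.log (1 + T / (d * lam))) := by
    intro ω hω T hT d hd
    refine le_trans ?_ (sum_confCoeff_mul_confWidth_le hφ hlam hk_le hB hb hd)
    rw [← Finset.sum_sub_distrib]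
    refine Finset.sum_le_sum fun t ht => ?_
    obtain ⟨h1t, htT⟩ := Finset.mem_Icc.1 ht
    have htN : ∀ s ≤ t, (s : ℕ∞) ≤ N := fun s hs =>
      le_trans (by exact_mod_cast hs.trans htT) hT
    have hband := abs_inner_sub_ridgeEstimate_le_confCoeff (z := fun τ => (x τ ω, a τ ω))
      (n := t - 1) (y := fun τ => y τ ω) (e := fun τ => n τ ω) hφ hl hb hf
      (fun i hi => by
        rw [hy (i + 1) (by omega) (htN _ (by omega)) ω, apply_eq_inner_kerFun])
      (hconf ω hω (t - 1) (htN _ (by omega)))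
    have hU : ∀ w, f w ≤ ucb (scalarKernel H) (fun τ => (x τ ω, a τ ω)) (fun τ => y τ ω)
        lam B b δ t w := fun w => by
      have := (abs_le.1 (hband w)).2
      rw [← apply_eq_inner_kerFun] at this
      rw [ucb]
      linarith
    have h := maxMinValue_le (hx t h1t (htN t le_rfl) ω) (ha t h1t (htN t le_rfl) ω)
      (neg_norm_le_apply hk_le f) hU
    have hlow := (abs_le.1 (hband (x t ω, a t ω))).1
    rw [← apply_eq_inner_kerFun] at hlow
    rw [ucb] at h
    linarith
  refine ⟨good, hgood, hP, fun ω hω => ⟨fun T _ hT d hd => ?_, ?_⟩⟩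
  · have := hregret ω hω T hT d hd
    linarith
  · rintro rfl ⟨D, hD⟩
    exact ⟨_, isLittleO_sqrt_mul_sq_log _, fun T =>
      (hregret ω hω T le_top _ rfl).trans
        (regret_bound_le hφ hlam hk_le hB hb hδ rfl (hD T))⟩
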